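/- **Critically feasible control.** Let $n\ge 1$, let $A:[0,1]\to\mathbb R^{n\times n}$ and $B=(b_1|\cdots|b_m):[0,1]\to\mathbb R^{n\times m}$ be continuous and let $\varphi:\mathbb R^n\times\mathbb R^n\to\mathbb R^r$ be affine. Let $\mathcal A$ be the set of $u\in L^2([0,1];\mathbb R^m)$ for which some $x\in W^{1,2}([0,1];\mathbb R^n)$ satisfies $\dot x=Ax+Bu$ a.e. on $[0,1]$ and $\varphi(x(0),x(1))=0$; assume $\mathcal A\neq\emptyset$. For $a\ge 0$ let $\mathcal B_a$ be the set of $u\in L^2([0,1];\mathbb R^m)$ with $|u_i(t)|\le a$ for all $i$ and a.e. $t\in[0,1]$. Say that the system is *controllable w.r.t. $u_i$ on $[s,s']$* if for every $x_0\in\mathbb R^n$ there is a continuous $v:[s,s']\to\mathbb R$ such that the solution of $\dot x=Ax+b_i v$, $x(s)=x_0$, satisfies $x(s')=0$. Then there is a smallest $a\ge0$, denoted $a_c$, with $\mathcal A\cap\mathcal B_a\ne\emptyset$, and there is a solution $\lambda:[0,1]\to\mathbb R^n$ of the adjoint equation $\dot\lambda=-A^T\lambda$, with $\lambda(t)\ne0$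 for all $t\in[0,1]$, such that the following holds for every critically feasible control $u\in\mathcal A\cap\mathcal B_{a_c}$ and every index $i$ such that the system is controllable w.r.t. $u_i$ on every $[s,s']\subset[0,1]$ with $s<s'$. 1. There is no interval $[s,s']\subset[0,1]$ with $s<s'$ on which $b_i^T\lambda=0$ a.e.; and for a.e. $t\in[0,1]$, $u_i(t)=a_c$ if $b_i^T(t)\lambda(t)<0$, and $u_i(t)=-a_c$ if $b_i^T(t)\lambda(t)>0$. 2. If moreover $A$ and $b_i$ are real-analytic on $[0,1]$, then $u_i$ is of bang–bang type: for a.e. $t\in[0,1]$ one has $b_i^T(t)\lambda(t)\neq0$ and $$u_i(t)=\begin{cases}a_c,& b_i^T(t)\lambda(t)\le0,\\ -a_c,& b_i^T(t)\lambda(t)>0.\end{cases}$$ -/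

import Mathlib

open MeasureTheory Set
open scoped Matrix

namespace CriticalControl

/-- Lebesgue measure on the time horizon `[0,1]`. -/
noncomputable def timeMeasure : Measure ℝ := volume.restrict (Icc (0 : ℝ) 1)

/-- `x ∈ W^{1,2}([0,1]; ℝⁿ)`, through its continuous representative: `x` is absolutely continuous
on `[0,1]` and its (a.e. defined) derivative is square integrable. -/
def IsW12 {n : ℕ} (x : ℝ → Fin n → ℝ) : Prop :=
  AbsolutelyContinuousOnInterval x 0 1 ∧ MemLp (deriv x) 2 timeMeasure

/-- The set `𝓐`: the controls `u ∈ L²([0,1]; ℝᵐ)` for which some `x ∈ W^{1,2}([0,1]; ℝⁿ)` solves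
`x' = A x + B u` a.e. on `[0,1]` and satisfies the boundary conditions `φ(x(0), x(1)) = 0`. -/
def admissible {n m r : ℕ} (A : ℝ → Matrix (Fin n) (Fin n) ℝ) (B : ℝ → Matrix (Fin n) (Fin m) ℝ)
    (φ : ((Fin n → ℝ) × (Fin n → ℝ)) →ᵃ[ℝ] (Fin r → ℝ)) : Set (ℝ → Fin m → ℝ) :=
  {u | MemLp u 2 timeMeasure ∧
    ∃ x : ℝ → Fin n → ℝ, IsW12 x ∧
      (∀ᵐ t ∂timeMeasure, HasDerivAt x (A t *ᵥ x t + B t *ᵥ u t) t) ∧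
      φ (x 0, x 1) = 0}

/-- The box `𝓑_a`: the controls `u ∈ L²([0,1]; ℝᵐ)` with `-a ≤ u_i(t) ≤ a` for a.e. `t` and
all `i`. -/
def box (m : ℕ) (a : ℝ) : Set (ℝ → Fin m → ℝ) :=
  {u | MemLp u 2 timeMeasure ∧ ∀ᵐ t ∂timeMeasure, ∀ i, -a ≤ u t i ∧ u t i ≤ a}

/-- The control bounds `a ≥ 0` for which the problem is feasible, `𝓐 ∩ 𝓑_a ≠ ∅`. -/
def feasibleBounds {n m r : ℕ} (A : ℝ → Matrix (Fin n) (Fin n) ℝ)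
    (B : ℝ → Matrix (Fin n) (Fin m) ℝ)
    (φ : ((Fin n → ℝ) × (Fin n → ℝ)) →ᵃ[ℝ] (Fin r → ℝ)) : Set ℝ :=
  {a | 0 ≤ a ∧ (admissible A B φ ∩ box m a).Nonempty}

/-- The critical bound `a_c`. -/
noncomputable def criticalBound {n m r : ℕ} (A : ℝ → Matrix (Fin n) (Fin n) ℝ)
    (B : ℝ → Matrix (Fin n) (Fin m) ℝ)
    (φ : ((Fin n → ℝ) × (Fin n → ℝ)) →ᵃ[ℝ] (Fin r → ℝ)) : ℝ :=
  sInf (feasibleBounds A B φ)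

/-- The system with the single scalar control column `b` is controllable on `[s, s']`: every
initial state at time `s` is steered to `0` at time `s'` by some continuous control, along
`x' = A x + v b`. -/
def ControllableOn {n : ℕ} (A : ℝ → Matrix (Fin n) (Fin n) ℝ) (b : ℝ → Fin n → ℝ)
    (s s' : ℝ) : Prop :=
  ∀ x₀ : Fin n → ℝ, ∃ (v : ℝ → ℝ) (x : ℝ → Fin n → ℝ), ContinuousOn v (Icc s s') ∧
    (∀ t ∈ Icc s s', HasDerivWithinAt x (A t *ᵥ x t + v t • b t) (Icc s s') t) ∧
    x s = x₀ ∧ x s' = 0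

/-- The system `x' = A x + B u` is controllable with respect to the component `u_i` on every
nondegenerate subinterval of `[0,1]`. -/
def ControllableWrt {n m : ℕ} (A : ℝ → Matrix (Fin n) (Fin n) ℝ)
    (B : ℝ → Matrix (Fin n) (Fin m) ℝ) (i : Fin m) : Prop :=
  ∀ s s' : ℝ, 0 ≤ s → s < s' → s' ≤ 1 → ControllableOn A (fun t => (B t).col i) s s'

/-- `p` solves the adjoint equation `p' = -Aᵀ p` on `[0,1]`. -/
def IsAdjoint {n : ℕ} (A : ℝ → Matrix (Fin n) (Fin n) ℝ) (p : ℝ → Fin n → ℝ) : Prop :=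
  ∀ t ∈ Icc (0 : ℝ) 1, HasDerivWithinAt p (-((A t)ᵀ *ᵥ p t)) (Icc 0 1) t

/-- The switching function `b_i(t)ᵀ p(t)` of the component `u_i`, where `b_i` is the `i`-th
column of `B`. -/
def switching {n m : ℕ} (B : ℝ → Matrix (Fin n) (Fin m) ℝ) (p : ℝ → Fin n → ℝ) (i : Fin m)
    (t : ℝ) : ℝ :=
  (B t).col i ⬝ᵥ p t

end CriticalControl

namespace CriticalControl

open Filter Topology
open scoped NNReal

/-! ### Linear differential equations on `[0,1]` -/

/-! By variation of constants, a control enters the boundary conditions only through the vector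
`steer Ψ B u` in ℝⁿ, the integral of `Ψ B u` with `Ψ` the inverse fundamental matrix: `u` is
admissible exactly when this vector lies in an affine subspace K
(`IsFundamentalPair.mem_admissible_iff`). The control problem thus becomes finite-dimensional convex
geometry.

The critical bound is finite because bounded controls already reach every value of `steer`
(`exists_box_steer_eq`). It is attained because decreasing bounded closed convex sets in a Hilbert
space have a common point (`exists_steer_mem_of_forall_gt`).

For a > 0 critical, the values steered by controls with bound strictly below a form a convex set O
disjoint from K. Controllability in a single component makes `steer` onto, hence O open, and
Hahn-Banach separates O from K by some q ≠ 0 (`exists_multiplier`). Every critical control steers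
into K, so one and the same q works for all of them: each minimises q · `steer` over the box. With λ
= Ψᵀq, a nowhere vanishing adjoint solution, this functional is the integral of (Bᵀλ) · u, and
minimising it pointwise gives the sign law (`bang_bang_of_minimizer`).

If bᵢᵀλ vanished on an interval, λ · x would be constant along every trajectory driven by uᵢ alone,
contradicting controllability (`no_singular_arc`). For analytic data λ is analytic, so the switching
function, not being identically zero, vanishes only on a null set. -/

theorem exists_norm_mulVec_le {m n : ℕ} {A : ℝ → Matrix (Fin m) (Fin n) ℝ} {s : Set ℝ}
    (hs : IsCompact s) (hA : ContinuousOn A s) :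
    ∃ C : ℝ≥0, ∀ t ∈ s, ∀ v, ‖A t *ᵥ v‖ ≤ C * ‖v‖ := by
  have hc : ContinuousOn (fun t => ∑ i, ∑ j, |A t i j|) s :=
    continuousOn_finsetSum _ fun i _ => continuousOn_finsetSum _ fun j _ =>
      ((continuous_id.matrix_elem i j).comp_continuousOn hA).abs
  obtain ⟨C, hC⟩ := hs.exists_bound_of_continuousOn hc
  refine ⟨C.toNNReal, fun t ht v => ?_⟩
  refine (pi_norm_le_iff_of_nonneg (by positivity)).2 fun i => ?_
  have h1 : ∑ j, |A t i j| ≤ C.toNNReal := by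
    refine le_trans ?_ (Real.le_coe_toNNReal C)
    refine le_trans ?_ ((le_abs_self _).trans (hC t ht))
    exact Finset.single_le_sum (f := fun i => ∑ j, |A t i j|)
      (fun i _ => Finset.sum_nonneg fun j _ => abs_nonneg _) (Finset.mem_univ i)
  calc ‖(A t *ᵥ v) i‖ ≤ ∑ j, ‖A t i j * v j‖ := norm_sum_le Finset.univ fun j => A t i j * v j
    _ ≤ ∑ j, |A t i j| * ‖v‖ := by
        gcongr with j
        rw [norm_mul]
        exact mul_le_mul_of_nonneg_left (norm_le_pi_norm v j) (abs_nonneg _)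
    _ = (∑ j, |A t i j|) * ‖v‖ := by rw [Finset.sum_mul]
    _ ≤ _ := by gcongr

/-- Coordinatewise truncation to `[-ρ, ρ]`. -/
def clampVec {n : ℕ} (ρ : ℝ) (v : Fin n → ℝ) : Fin n → ℝ := fun i => max (-ρ) (min ρ (v i))

theorem abs_max_min_sub_le (a b x y : ℝ) :
    |max a (min b x) - max a (min b y)| ≤ |x - y| := by
  refine (abs_max_sub_max_le_max _ _ _ _).trans ?_
  simp only [sub_self, abs_zero]
  refine max_le (abs_nonneg _) ((abs_min_sub_min_le_max _ _ _ _).trans ?_)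
  simp

theorem norm_clampVec_sub_le {n : ℕ} (ρ : ℝ) (v w : Fin n → ℝ) :
    ‖clampVec ρ v - clampVec ρ w‖ ≤ ‖v - w‖ :=
  (pi_norm_le_iff_of_nonneg (norm_nonneg _)).2 fun i =>
    (abs_max_min_sub_le _ _ _ _).trans (norm_le_pi_norm (v - w) i)

theorem norm_clampVec_le {n : ℕ} {ρ : ℝ} (hρ : 0 ≤ ρ) (v : Fin n → ℝ) : ‖clampVec ρ v‖ ≤ ρ :=
  (pi_norm_le_iff_of_nonneg hρ).2 fun i => abs_le.2
    ⟨le_max_left _ _, max_le (by linarith) (min_le_left _ _)⟩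

theorem clampVec_eq_self {n : ℕ} {ρ : ℝ} {v : Fin n → ℝ} (hv : ‖v‖ ≤ ρ) : clampVec ρ v = v := by
  funext i
  have := abs_le.1 ((norm_le_pi_norm v i).trans hv)
  simp [clampVec, this.1, this.2]

theorem clampVec_zero {n : ℕ} {ρ : ℝ} (hρ : 0 ≤ ρ) : clampVec ρ (0 : Fin n → ℝ) = 0 :=
  clampVec_eq_self (by simpa using hρ)

/-- Picard-Lindelöf on the whole interval needs a bounded field, so it is applied to the field
truncated at radius `ρ`. Grönwall then confines the solution to the region where the truncation is
inactive. -/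
theorem exists_linear_ode_solution {n : ℕ} {A : ℝ → Matrix (Fin n) (Fin n) ℝ}
    (hA : ContinuousOn A (Icc 0 1)) (x₀ : Fin n → ℝ) :
    ∃ x : ℝ → Fin n → ℝ, x 0 = x₀ ∧
      ∀ t ∈ Icc (0 : ℝ) 1, HasDerivWithinAt x (A t *ᵥ x t) (Icc 0 1) t := by
  obtain ⟨C, hC⟩ := exists_norm_mulVec_le isCompact_Icc hA
  -- The a priori Grönwall bound for a solution of the linear equation on an interval of length one.
  set ρ : ℝ≥0 := ‖x₀‖₊ * (Real.exp C).toNNReal with hρ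
  have hρ0 : (0 : ℝ) ≤ ρ := ρ.2
  have hρe : (ρ : ℝ) = ‖x₀‖ * Real.exp C := by
    simp [hρ, Real.exp_nonneg]
  have hPL : IsPicardLindelof (fun t v => A t *ᵥ clampVec ρ v)
      (⟨0, by simp⟩ : Icc (0 : ℝ) 1) x₀ (C * ρ) 0 (C * ρ) C := by
    refine ⟨fun t ht => ?_, fun v _ => ?_, fun t ht v _ => ?_, by simp⟩
    · refine LipschitzOnWith.of_dist_le_mul fun v _ w _ => ?_
      rw [dist_eq_norm, dist_eq_norm, ← Matrix.mulVec_sub]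
      refine (hC t ht _).trans ?_
      gcongr
      exact norm_clampVec_sub_le _ _ _
    · exact (continuous_id.matrix_mulVec continuous_const).comp_continuousOn hA
    · refine (hC t ht _).trans ?_
      push_cast
      gcongr
      exact norm_clampVec_le hρ0 v
  obtain ⟨x, hx0, hx⟩ := hPL.exists_eq_forall_mem_Icc_hasDerivWithinAt₀
  refine ⟨x, hx0, fun t ht => ?_⟩
  have hb : ‖x t‖ ≤ ρ := by
    -- Truncation is 1-Lipschitz and fixes 0, so the truncated field obeys the same linear growth
    -- bound as the original one.
    have := norm_le_gronwallBound_of_norm_deriv_right_le (f := x) (δ := ‖x₀‖) (K := C) (ε := 0)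
      (a := 0) (b := 1) (fun t ht => (hx t ht).continuousWithinAt)
      (fun t ht => (hx t (Ico_subset_Icc_self ht)).mono_of_mem_nhdsWithin
        (Icc_mem_nhdsGE_of_mem ht)) (by simp at hx0; rw [hx0]) (fun t ht => by
          refine (hC t (Ico_subset_Icc_self ht) _).trans ?_
          have := norm_clampVec_sub_le ρ (x t) 0
          rw [clampVec_zero hρ0, sub_zero, sub_zero] at this
          rw [add_zero]; gcongr) t ht
    rw [gronwallBound_ε0, sub_zero] at this
    rw [hρe]
    refine this.trans ?_
    gcongr
    exact mul_le_of_le_one_right C.2 ht.2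
  have := hx t ht
  rwa [clampVec_eq_self hb] at this

/-- `Φ` is a fundamental matrix of `x' = A x` on `[0,1]` with inverse `Ψ`. -/
structure IsFundamentalPair {n : ℕ} (A Φ Ψ : ℝ → Matrix (Fin n) (Fin n) ℝ) : Prop where
  deriv_left : ∀ q, ∀ t ∈ Icc (0 : ℝ) 1,
    HasDerivWithinAt (fun t => Φ t *ᵥ q) (A t *ᵥ (Φ t *ᵥ q)) (Icc 0 1) t
  adjoint : ∀ q, IsAdjoint A (fun t => q ᵥ* Ψ t)
  left_zero : Φ 0 = 1
  right_zero : Ψ 0 = 1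
  inv_mul : ∀ t ∈ Icc (0 : ℝ) 1, Ψ t * Φ t = 1

theorem hasDerivWithinAt_pi_apply {n : ℕ} {x : ℝ → Fin n → ℝ} {x' : Fin n → ℝ} {s : Set ℝ} {t : ℝ}
    (h : HasDerivWithinAt x x' s t) (i : Fin n) :
    HasDerivWithinAt (fun t => x t i) (x' i) s t :=
  hasDerivWithinAt_pi.1 h i

theorem hasDerivWithinAt_dotProduct {n : ℕ} {x y : ℝ → Fin n → ℝ} {x' y' : Fin n → ℝ}
    {s : Set ℝ} {t : ℝ} (hx : HasDerivWithinAt x x' s t) (hy : HasDerivWithinAt y y' s t) :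
    HasDerivWithinAt (fun t => x t ⬝ᵥ y t) (x' ⬝ᵥ y t + x t ⬝ᵥ y') s t := by
  simp only [dotProduct, ← Finset.sum_add_distrib]
  exact HasDerivWithinAt.fun_sum fun i _ =>
    (hasDerivWithinAt_pi_apply hx i).fun_mul (hasDerivWithinAt_pi_apply hy i)

theorem neg_transpose_mulVec_dotProduct_add {n : ℕ} (A : Matrix (Fin n) (Fin n) ℝ)
    (p x w : Fin n → ℝ) : -(Aᵀ *ᵥ p) ⬝ᵥ x + p ⬝ᵥ (A *ᵥ x + w) = p ⬝ᵥ w := by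
  rw [dotProduct_add, Matrix.mulVec_transpose, neg_dotProduct, Matrix.dotProduct_mulVec]
  ring

theorem eq_of_hasDerivWithinAt_Icc_zero {f : ℝ → ℝ} {a b : ℝ}
    (h : ∀ t ∈ Icc a b, HasDerivWithinAt f 0 (Icc a b) t) {t : ℝ} (ht : t ∈ Icc a b) :
    f t = f a :=
  constant_of_has_deriv_right_zero (fun t ht => (h t ht).continuousWithinAt)
    (fun t ht => (h t (Ico_subset_Icc_self ht)).mono_of_mem_nhdsWithin
      (Icc_mem_nhdsGE_of_mem ht)) t ht

/-- The columns of `Φ` solve the primal equation and the rows of `Ψ` the adjoint one. Each pairing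
of a row with a column has zero derivative, so `Ψ t * Φ t` keeps its initial value 1; no determinant
argument is needed. -/
theorem exists_isFundamentalPair {n : ℕ} {A : ℝ → Matrix (Fin n) (Fin n) ℝ}
    (hA : ContinuousOn A (Icc 0 1)) : ∃ Φ Ψ, IsFundamentalPair A Φ Ψ := by
  have hA' : ContinuousOn (fun t => -(A t)ᵀ) (Icc 0 1) :=
    (continuous_id.matrix_transpose.neg).comp_continuousOn hA
  choose x hx0 hx using fun j : Fin n => exists_linear_ode_solution hA (Pi.single j 1)
  choose p hp0 hp using fun j : Fin n => exists_linear_ode_solution hA' (Pi.single j 1)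
  have hp' : ∀ j, IsAdjoint A (p j) := fun j t ht => by
    simpa [Matrix.neg_mulVec] using hp j t ht
  refine ⟨fun t => Matrix.of fun i j => x j t i, fun t => Matrix.of fun i j => p i t j, ?_, ?_, ?_, ?_, ?_⟩
  · intro q t ht
    have h1 : ∀ s, (Matrix.of fun i j => x j s i) *ᵥ q = ∑ j, q j • x j s := fun s => by
      ext i; simp [Matrix.mulVec, dotProduct, mul_comm]
    simp only [h1, Matrix.mulVec_sum, Matrix.mulVec_smul]
    exact HasDerivWithinAt.fun_sum fun j _ => (hx j t ht).fun_const_smul (q j)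
  · intro q t ht
    have h1 : ∀ s, q ᵥ* (Matrix.of fun i j => p i s j) = ∑ j, q j • p j s := fun s => by
      ext i; simp [Matrix.vecMul, dotProduct]
    simp only [h1, Matrix.mulVec_sum, Matrix.mulVec_smul, ← Finset.sum_neg_distrib, ← smul_neg]
    exact HasDerivWithinAt.fun_sum fun j _ => (hp' j t ht).fun_const_smul (q j)
  · ext i j; simp [hx0, Matrix.one_apply, Pi.single_apply]
  · ext i j; simp [hp0, Matrix.one_apply, Pi.single_apply, eq_comm]
  · intro t ht
    ext i j
    have h2 : ∀ t ∈ Icc (0 : ℝ) 1,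
        HasDerivWithinAt (fun t => p i t ⬝ᵥ x j t) 0 (Icc 0 1) t := fun t ht => by
      have := hasDerivWithinAt_dotProduct (hp' i t ht) (hx j t ht)
      have h3 := neg_transpose_mulVec_dotProduct_add (A t) (p i t) (x j t) 0
      rw [add_zero, dotProduct_zero] at h3
      rwa [h3] at this
    have := eq_of_hasDerivWithinAt_Icc_zero h2 ht
    simp only [Matrix.mul_apply', Matrix.one_apply]
    refine Eq.trans this ?_
    rw [hp0, hx0]
    simp [Pi.single_apply, eq_comm]

/-! ### Absolutely continuous solutions and the variation of constants formula -/

theorem _root_.AbsolutelyContinuousOnInterval.apply {n : ℕ} {x : ℝ → Fin n → ℝ} {a b : ℝ}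
    (hx : AbsolutelyContinuousOnInterval x a b) (i : Fin n) :
    AbsolutelyContinuousOnInterval (fun t => x t i) a b :=
  squeeze_zero (fun _ => Finset.sum_nonneg fun _ _ => dist_nonneg)
    (fun _ => Finset.sum_le_sum fun _ _ => dist_le_pi_dist _ _ i) hx

theorem absolutelyContinuousOnInterval_pi {n : ℕ} {x : ℝ → Fin n → ℝ} {a b : ℝ}
    (hx : ∀ i, AbsolutelyContinuousOnInterval (fun t => x t i) a b) :
    AbsolutelyContinuousOnInterval x a b := by
  refine squeeze_zero (fun _ => Finset.sum_nonneg fun _ _ => dist_nonneg) (fun E => ?_)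
    (by simpa using tendsto_finsetSum Finset.univ fun i _ => hx i)
  rw [Finset.sum_comm]
  refine Finset.sum_le_sum fun k _ => ?_
  refine (dist_pi_le_iff (Finset.sum_nonneg fun _ _ => dist_nonneg)).2 fun i => ?_
  exact Finset.single_le_sum (f := fun i => dist (x (E.2 k).1 i) (x (E.2 k).2 i))
    (fun _ _ => dist_nonneg) (Finset.mem_univ i)

theorem absolutelyContinuousOnInterval_sum {ι : Type*} (s : Finset ι) {f : ι → ℝ → ℝ} {a b : ℝ}
    (hf : ∀ i ∈ s, AbsolutelyContinuousOnInterval (f i) a b) :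
    AbsolutelyContinuousOnInterval (fun t => ∑ i ∈ s, f i t) a b := by
  classical
  induction s using Finset.induction_on with
  | empty =>
    simpa using (LipschitzWith.const (0 : ℝ)).lipschitzOnWith.absolutelyContinuousOnInterval
  | insert i s hi ih =>
    simp only [Finset.sum_insert hi]
    exact (hf i (Finset.mem_insert_self _ _)).fun_add
      (ih fun j hj => hf j (Finset.mem_insert_of_mem hj))

theorem absolutelyContinuousOnInterval_dotProduct {n : ℕ} {x y : ℝ → Fin n → ℝ} {a b : ℝ}
    (hx : AbsolutelyContinuousOnInterval x a b) (hy : AbsolutelyContinuousOnInterval y a b) :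
    AbsolutelyContinuousOnInterval (fun t => x t ⬝ᵥ y t) a b :=
  absolutelyContinuousOnInterval_sum _ fun i _ => (hx.apply i).fun_mul (hy.apply i)

theorem absolutelyContinuousOnInterval_of_hasDerivWithinAt {E : Type*} [NormedAddCommGroup E]
    [NormedSpace ℝ E] {f f' : ℝ → E} {a b : ℝ} (hab : a ≤ b)
    (hf : ∀ t ∈ Icc a b, HasDerivWithinAt f (f' t) (Icc a b) t)
    (hf' : ContinuousOn f' (Icc a b)) : AbsolutelyContinuousOnInterval f a b := by
  obtain ⟨C, hC⟩ := isCompact_Icc.exists_bound_of_continuousOn hf'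
  have : LipschitzOnWith C.toNNReal f (uIcc a b) := by
    rw [uIcc_of_le hab]
    refine (convex_Icc a b).lipschitzOnWith_of_nnnorm_hasDerivWithin_le hf fun t ht => ?_
    rw [← NNReal.coe_le_coe, coe_nnnorm]
    exact (hC t ht).trans (Real.le_coe_toNNReal C)
  exact this.absolutelyContinuousOnInterval

theorem continuousOn_mulVec {m n : ℕ} {A : ℝ → Matrix (Fin m) (Fin n) ℝ} {x : ℝ → Fin n → ℝ}
    {s : Set ℝ} (hA : ContinuousOn A s) (hx : ContinuousOn x s) :
    ContinuousOn (fun t => A t *ᵥ x t) s :=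
  (continuous_fst.matrix_mulVec continuous_snd).comp_continuousOn (hA.prodMk hx)

theorem continuousOn_transpose {m n : ℕ} {A : ℝ → Matrix (Fin m) (Fin n) ℝ}
    {s : Set ℝ} (hA : ContinuousOn A s) : ContinuousOn (fun t => (A t)ᵀ) s :=
  continuous_id.matrix_transpose.comp_continuousOn hA

theorem IsAdjoint.continuousOn {n : ℕ} {A : ℝ → Matrix (Fin n) (Fin n) ℝ} {p : ℝ → Fin n → ℝ}
    (hp : IsAdjoint A p) : ContinuousOn p (Icc 0 1) :=
  fun t ht => (hp t ht).continuousWithinAt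

theorem IsAdjoint.absolutelyContinuous {n : ℕ} {A : ℝ → Matrix (Fin n) (Fin n) ℝ}
    {p : ℝ → Fin n → ℝ} (hp : IsAdjoint A p) (hA : ContinuousOn A (Icc 0 1)) :
    AbsolutelyContinuousOnInterval p 0 1 :=
  absolutelyContinuousOnInterval_of_hasDerivWithinAt zero_le_one hp
    (continuousOn_mulVec (continuousOn_transpose hA) hp.continuousOn).neg

/-! ### Measurability and integrability on the time horizon -/

instance isFiniteMeasure_timeMeasure : IsFiniteMeasure timeMeasure := by
  unfold timeMeasure; infer_instance

theorem ae_timeMeasure_mem_Ioo : ∀ᵐ t ∂timeMeasure, t ∈ Ioo (0 : ℝ) 1 := by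
  rw [timeMeasure, ← restrict_Ioo_eq_restrict_Icc]
  exact ae_restrict_mem measurableSet_Ioo

theorem ae_timeMeasure_mem_Icc : ∀ᵐ t ∂timeMeasure, t ∈ Icc (0 : ℝ) 1 :=
  ae_timeMeasure_mem_Ioo.mono fun _ h => Ioo_subset_Icc_self h

theorem ae_timeMeasure_of_ae {P : ℝ → Prop} (h : ∀ᵐ t, P t) : ∀ᵐ t ∂timeMeasure, P t :=
  ae_restrict_of_ae h

theorem integral_timeMeasure {E : Type*} [NormedAddCommGroup E] [NormedSpace ℝ E] (f : ℝ → E) :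
    ∫ t, f t ∂timeMeasure = ∫ t in (0 : ℝ)..1, f t := by
  rw [timeMeasure, intervalIntegral.integral_of_le zero_le_one, integral_Icc_eq_integral_Ioc]

theorem integrable_timeMeasure_iff {E : Type*} [NormedAddCommGroup E] (f : ℝ → E) :
    Integrable f timeMeasure ↔ IntervalIntegrable f volume 0 1 := by
  rw [intervalIntegrable_iff_integrableOn_Icc_of_le zero_le_one]; rfl

theorem aestronglyMeasurable_of_continuousOn {E : Type*} [TopologicalSpace E]
    [TopologicalSpace.PseudoMetrizableSpace E] {f : ℝ → E}
    (hf : ContinuousOn f (Icc 0 1)) : AEStronglyMeasurable f timeMeasure :=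
  hf.aestronglyMeasurable measurableSet_Icc

theorem continuousOn_entry {m n : ℕ} {A : ℝ → Matrix (Fin m) (Fin n) ℝ}
    {s : Set ℝ} (hA : ContinuousOn A s) (i : Fin m) (j : Fin n) : ContinuousOn (fun t => A t i j) s :=
  (continuous_id.matrix_elem i j).comp_continuousOn hA

theorem memLp_mulVec {m n : ℕ} {A : ℝ → Matrix (Fin m) (Fin n) ℝ} {u : ℝ → Fin n → ℝ}
    {q : ENNReal} (hA : ContinuousOn A (Icc 0 1)) (hu : MemLp u q timeMeasure) :
    MemLp (fun t => A t *ᵥ u t) q timeMeasure := by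
  obtain ⟨C, hC⟩ := exists_norm_mulVec_le isCompact_Icc hA
  refine hu.of_le_mul (c := C) ?_ (ae_timeMeasure_mem_Icc.mono fun t ht => hC t ht _)
  refine (aemeasurable_pi_iff.2 fun i => ?_).aestronglyMeasurable
  refine AEStronglyMeasurable.aemeasurable ?_
  simp only [Matrix.mulVec, dotProduct]
  exact Finset.aestronglyMeasurable_fun_sum _ fun j _ =>
    (aestronglyMeasurable_of_continuousOn (continuousOn_entry hA i j)).mul
      (aemeasurable_pi_iff.1 hu.1.aemeasurable j).aestronglyMeasurable

theorem memLp_of_continuousOn {E : Type*} [NormedAddCommGroup E] {f : ℝ → E} {q : ENNReal}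
    (hf : ContinuousOn f (Icc 0 1)) : MemLp f q timeMeasure := by
  obtain ⟨C, hC⟩ := isCompact_Icc.exists_bound_of_continuousOn hf
  exact MemLp.of_bound (aestronglyMeasurable_of_continuousOn hf) C
    (ae_timeMeasure_mem_Icc.mono hC)

theorem hasDerivAt_dotProduct {n : ℕ} {x y : ℝ → Fin n → ℝ} {x' y' : Fin n → ℝ}
    {t : ℝ} (hx : HasDerivAt x x' t) (hy : HasDerivAt y y' t) :
    HasDerivAt (fun t => x t ⬝ᵥ y t) (x' ⬝ᵥ y t + x t ⬝ᵥ y') t := by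
  rw [← hasDerivWithinAt_univ] at *
  exact hasDerivWithinAt_dotProduct hx hy

/-- Green's identity between the adjoint equation and the inhomogeneous linear equation. -/
theorem IsAdjoint.integral_dotProduct {n : ℕ} {A : ℝ → Matrix (Fin n) (Fin n) ℝ}
    {p x w : ℝ → Fin n → ℝ} (hp : IsAdjoint A p) (hA : ContinuousOn A (Icc 0 1))
    (hx : AbsolutelyContinuousOnInterval x 0 1)
    (hxw : ∀ᵐ t ∂timeMeasure, HasDerivAt x (A t *ᵥ x t + w t) t) :
    ∫ t, p t ⬝ᵥ w t ∂timeMeasure = p 1 ⬝ᵥ x 1 - p 0 ⬝ᵥ x 0 := by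
  rw [← (absolutelyContinuousOnInterval_dotProduct
    (hp.absolutelyContinuous hA) hx).integral_deriv_eq_sub, ← integral_timeMeasure]
  refine integral_congr_ae ?_
  filter_upwards [hxw, ae_timeMeasure_mem_Ioo] with t ht ht'
  have h1 := (hp t (Ioo_subset_Icc_self ht')).hasDerivAt (Icc_mem_nhds ht'.1 ht'.2)
  rw [(hasDerivAt_dotProduct h1 ht).deriv, neg_transpose_mulVec_dotProduct_add]

/-- The steering functional `u ↦ ∫₀¹ Ψ B u`. -/
noncomputable def steer {n m : ℕ} (Ψ : ℝ → Matrix (Fin n) (Fin n) ℝ)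
    (B : ℝ → Matrix (Fin n) (Fin m) ℝ) (u : ℝ → Fin m → ℝ) : Fin n → ℝ :=
  fun j => ∫ t, (Ψ t *ᵥ (B t *ᵥ u t)) j ∂timeMeasure

/-- The values of the steering functional which are compatible with the boundary conditions. -/
def target {n r : ℕ} (M : Matrix (Fin n) (Fin n) ℝ)
    (φ : ((Fin n → ℝ) × (Fin n → ℝ)) →ᵃ[ℝ] (Fin r → ℝ)) : Set (Fin n → ℝ) :=
  {y | ∃ x₀, φ (x₀, M *ᵥ (x₀ + y)) = 0}

section

variable {n m r : ℕ} {A Φ Ψ : ℝ → Matrix (Fin n) (Fin n) ℝ} {B : ℝ → Matrix (Fin n) (Fin m) ℝ}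
  {φ : ((Fin n → ℝ) × (Fin n → ℝ)) →ᵃ[ℝ] (Fin r → ℝ)}

theorem IsFundamentalPair.mul_inv (h : IsFundamentalPair A Φ Ψ) {t : ℝ} (ht : t ∈ Icc (0 : ℝ) 1) :
    Φ t * Ψ t = 1 :=
  mul_eq_one_comm.1 (h.inv_mul t ht)

theorem IsFundamentalPair.continuousOn_left (h : IsFundamentalPair A Φ Ψ) :
    ContinuousOn Φ (Icc 0 1) := by
  refine continuousOn_pi.2 fun i => continuousOn_pi.2 fun j => ?_
  have : ContinuousOn (fun t => Φ t *ᵥ Pi.single j 1) (Icc 0 1) :=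
    fun t ht => (h.deriv_left _ t ht).continuousWithinAt
  simpa using continuousOn_pi.1 this i

theorem IsFundamentalPair.continuousOn_right (h : IsFundamentalPair A Φ Ψ) :
    ContinuousOn Ψ (Icc 0 1) := by
  refine continuousOn_pi.2 fun i => continuousOn_pi.2 fun j => ?_
  simpa using continuousOn_pi.1 (h.adjoint (Pi.single i 1)).continuousOn j

/-- Green's identity applied to each row of `Ψ`. -/
theorem IsFundamentalPair.steer_eq (h : IsFundamentalPair A Φ Ψ) (hA : ContinuousOn A (Icc 0 1))
    {x : ℝ → Fin n → ℝ} {u : ℝ → Fin m → ℝ} (hx : AbsolutelyContinuousOnInterval x 0 1)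
    (hxu : ∀ᵐ t ∂timeMeasure, HasDerivAt x (A t *ᵥ x t + B t *ᵥ u t) t) :
    steer Ψ B u = Ψ 1 *ᵥ x 1 - x 0 := by
  funext j
  have := (h.adjoint (Pi.single j 1)).integral_dotProduct hA hx hxu
  simp only [← Matrix.dotProduct_mulVec, single_dotProduct, one_mul, h.right_zero,
    Matrix.one_mulVec] at this
  exact this

/-- Variation of constants: x = Φ y, where y is the integral of `Ψ B u` started at `x₀`. -/
theorem IsFundamentalPair.exists_trajectory (h : IsFundamentalPair A Φ Ψ)
    (hA : ContinuousOn A (Icc 0 1)) (hB : ContinuousOn B (Icc 0 1)) {u : ℝ → Fin m → ℝ}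
    (hu : MemLp u 2 timeMeasure) (x₀ : Fin n → ℝ) :
    ∃ x : ℝ → Fin n → ℝ, IsW12 x ∧
      (∀ᵐ t ∂timeMeasure, HasDerivAt x (A t *ᵥ x t + B t *ᵥ u t) t) ∧
      x 0 = x₀ ∧ x 1 = Φ 1 *ᵥ (x₀ + steer Ψ B u) := by
  set g : ℝ → Fin n → ℝ := fun t => Ψ t *ᵥ (B t *ᵥ u t) with hg
  have hgL : MemLp g 2 timeMeasure := memLp_mulVec h.continuousOn_right (memLp_mulVec hB hu)
  have hgi : ∀ j, IntervalIntegrable (fun t => g t j) volume 0 1 := fun j =>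
    (integrable_timeMeasure_iff _).1
      ((memLp_pi_iff.1 hgL j).integrable (by norm_num))
  set y : ℝ → Fin n → ℝ := fun t j => x₀ j + ∫ s in (0 : ℝ)..t, g s j with hy
  have hyAC : AbsolutelyContinuousOnInterval y 0 1 := by
    refine absolutelyContinuousOnInterval_pi fun j => ?_
    exact (LipschitzWith.const (x₀ j)).lipschitzOnWith.absolutelyContinuousOnInterval.fun_add
      ((hgi j).absolutelyContinuousOnInterval_intervalIntegral (by simp))
  have hyd : ∀ᵐ t ∂timeMeasure, HasDerivAt y (g t) t := by
    have : ∀ᵐ t ∂timeMeasure, ∀ j, t ∈ uIcc (0 : ℝ) 1 → ∀ c ∈ uIcc (0 : ℝ) 1,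
        HasDerivAt (fun x => ∫ s in c..x, g s j) (g t j) t :=
      ae_all_iff.2 fun j => ae_timeMeasure_of_ae (hgi j).ae_hasDerivAt_integral
    filter_upwards [this, ae_timeMeasure_mem_Icc] with t ht ht'
    exact hasDerivAt_pi.2 fun j =>
      (ht j (by rwa [uIcc_of_le zero_le_one]) 0 (by simp)).const_add _
  set x : ℝ → Fin n → ℝ := fun t => Φ t *ᵥ y t with hx
  -- `deriv_left` differentiates Φ q only for a fixed q, so Φ y is expanded over the columns of Φ.
  have hcol : ∀ t, x t = ∑ j, y t j • (Φ t *ᵥ Pi.single j 1) := fun t => by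
    ext i; simp [hx, Matrix.mulVec, dotProduct, mul_comm]
  have hΦAC : ∀ q, AbsolutelyContinuousOnInterval (fun t => Φ t *ᵥ q) 0 1 := fun q =>
    absolutelyContinuousOnInterval_of_hasDerivWithinAt zero_le_one (h.deriv_left q)
      (continuousOn_mulVec hA (continuousOn_mulVec h.continuousOn_left continuousOn_const))
  have hxAC : AbsolutelyContinuousOnInterval x 0 1 := by
    refine absolutelyContinuousOnInterval_pi fun i => ?_
    have : (fun t => x t i) = fun t => ∑ j, y t j * (Φ t *ᵥ Pi.single j 1) i := by
      funext t; rw [hcol]; simp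
    rw [this]
    exact absolutelyContinuousOnInterval_sum _ fun j _ => (hyAC.apply j).fun_mul ((hΦAC _).apply i)
  have hxd : ∀ᵐ t ∂timeMeasure, HasDerivAt x (A t *ᵥ x t + B t *ᵥ u t) t := by
    filter_upwards [hyd, ae_timeMeasure_mem_Ioo] with t ht ht'
    have ht'' := Ioo_subset_Icc_self ht'
    have h1 : HasDerivAt x (∑ j, (y t j • (A t *ᵥ (Φ t *ᵥ Pi.single j 1)) +
        g t j • (Φ t *ᵥ Pi.single j 1))) t := by
      rw [funext hcol]
      exact HasDerivAt.fun_sum fun j _ => (hasDerivAt_pi.1 ht j).fun_smul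
        ((h.deriv_left (Pi.single j 1) t ht'').hasDerivAt (Icc_mem_nhds ht'.1 ht'.2))
    convert h1 using 1
    have h2 : ∀ v : Fin n → ℝ, Φ t *ᵥ v = ∑ j, v j • (Φ t *ᵥ Pi.single j 1) := fun v => by
      ext i; simp [Matrix.mulVec, dotProduct, mul_comm]
    rw [Finset.sum_add_distrib, ← h2, hcol, Matrix.mulVec_sum]
    simp only [Matrix.mulVec_smul, hg]
    rw [Matrix.mulVec_mulVec _ (Φ t), h.mul_inv ht'', Matrix.one_mulVec]
  refine ⟨x, ⟨hxAC, ?_⟩, hxd, ?_, ?_⟩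
  · have hxc : ContinuousOn x (Icc 0 1) := by
      simpa using hxAC.continuousOn
    refine ((memLp_of_continuousOn (continuousOn_mulVec hA hxc)).add
      (memLp_mulVec hB hu)).ae_eq ?_
    filter_upwards [hxd] with t ht
    exact ht.deriv.symm
  · have : y 0 = x₀ := by funext j; simp [hy]
    simp [hx, this, h.left_zero]
  · have : y 1 = x₀ + steer Ψ B u := by
      funext j
      simp [hy, steer, integral_timeMeasure, hg]
    simp [hx, this]

theorem IsFundamentalPair.mem_admissible_iff (h : IsFundamentalPair A Φ Ψ)
    (hA : ContinuousOn A (Icc 0 1)) (hB : ContinuousOn B (Icc 0 1)) {u : ℝ → Fin m → ℝ} :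
    u ∈ admissible A B φ ↔ MemLp u 2 timeMeasure ∧ steer Ψ B u ∈ target (Φ 1) φ := by
  constructor
  · rintro ⟨hu, x, hx, hxu, hφ⟩
    refine ⟨hu, x 0, ?_⟩
    rw [h.steer_eq hA hx.1 hxu, add_sub_cancel, Matrix.mulVec_mulVec,
      h.mul_inv (by simp), Matrix.one_mulVec, hφ]
  · rintro ⟨hu, x₀, hφ⟩
    obtain ⟨x, hx, hxu, h0, h1⟩ := h.exists_trajectory hA hB hu x₀
    exact ⟨hu, x, hx, hxu, by rw [h0, h1, hφ]⟩

end

/-! ### The critical bound is attained -/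

/-- A substitute for weak compactness: the norms of the minimal-norm points increase and are
bounded, so the parallelogram law makes these points a Cauchy sequence, whose limit lies in every
set. -/
theorem nonempty_iInter_of_antitone_convex {H : Type*} [NormedAddCommGroup H]
    [InnerProductSpace ℝ H] [CompleteSpace H] {C : ℕ → Set H} (hanti : Antitone C)
    (hne : ∀ k, (C k).Nonempty) (hcl : ∀ k, IsClosed (C k)) (hcv : ∀ k, Convex ℝ (C k))
    {R : ℝ} (hR : ∀ k, ∃ x ∈ C k, ‖x‖ ≤ R) : (⋂ k, C k).Nonempty := by
  have key : ∀ k, ∃ x ∈ C k, ∀ y ∈ C k, ‖x‖ ≤ ‖y‖ := fun k => by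
    obtain ⟨x, hx, hmin⟩ := exists_norm_eq_iInf_of_complete_convex (hne k) (hcl k).isComplete
      (hcv k) 0
    refine ⟨x, hx, fun y hy => ?_⟩
    have := ciInf_le (f := fun w : C k => ‖(0 : H) - w‖)
      ⟨0, forall_mem_range.2 fun _ => norm_nonneg _⟩ ⟨y, hy⟩
    rw [← hmin] at this
    simpa using this
  choose x hx hmin using key
  have hmono : Monotone fun k => ‖x k‖ ^ 2 := fun k l hkl => by
    have := hmin k (x l) (hanti hkl (hx l))
    dsimp only
    gcongr
  have hbdd : BddAbove (range fun k => ‖x k‖ ^ 2) := by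
    refine ⟨R ^ 2, forall_mem_range.2 fun k => ?_⟩
    obtain ⟨y, hy, hyR⟩ := hR k
    have := (hmin k y hy).trans hyR
    gcongr
  have hcau : CauchySeq x := by
    have hc := (tendsto_atTop_ciSup hmono hbdd).cauchySeq
    rw [Metric.cauchySeq_iff'] at hc ⊢
    intro ε hε
    obtain ⟨N, hN⟩ := hc (ε ^ 2 / 2) (by positivity)
    refine ⟨N, fun k hk => ?_⟩
    have h1 := hN k hk
    rw [Real.dist_eq, abs_of_nonneg (sub_nonneg.2 (hmono hk))] at h1
    -- The midpoint stays in `C N`, so its norm is at least that of `x N`.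
    have h2 := hmin N ((1 / 2 : ℝ) • x k + (1 / 2 : ℝ) • x N)
      (hcv N (hanti hk (hx k)) (hx N) (by norm_num) (by norm_num) (by norm_num))
    rw [← smul_add, norm_smul] at h2
    norm_num at h2
    have h3 := parallelogram_law_with_norm ℝ (x k) (x N)
    rw [dist_eq_norm]
    have h4 := norm_nonneg (x N)
    refine lt_of_pow_lt_pow_left₀ 2 hε.le ?_
    nlinarith
  obtain ⟨y, hy⟩ := cauchySeq_tendsto_of_complete hcau
  refine ⟨y, mem_iInter.2 fun k => (hcl k).mem_of_tendsto hy ?_⟩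
  filter_upwards [eventually_ge_atTop k] with l hl
  exact hanti hl (hx l)

theorem box_mono {m : ℕ} {a a' : ℝ} (h : a ≤ a') : box m a ⊆ box m a' := fun _ hu =>
  ⟨hu.1, hu.2.mono fun _ ht i => ⟨(neg_le_neg h).trans (ht i).1, (ht i).2.trans h⟩⟩

theorem memLp_apply {m : ℕ} {u : ℝ → Fin m → ℝ} {q : ENNReal} (hu : MemLp u q timeMeasure)
    (i : Fin m) : MemLp (fun t => u t i) q timeMeasure :=
  memLp_pi_iff.1 hu i

section

variable {n m r : ℕ} {A Φ Ψ : ℝ → Matrix (Fin n) (Fin n) ℝ} {B : ℝ → Matrix (Fin n) (Fin m) ℝ}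
  {φ : ((Fin n → ℝ) × (Fin n → ℝ)) →ᵃ[ℝ] (Fin r → ℝ)}

theorem integrable_steer (hΨ : ContinuousOn Ψ (Icc 0 1)) (hB : ContinuousOn B (Icc 0 1))
    {u : ℝ → Fin m → ℝ} (hu : MemLp u 2 timeMeasure) (j : Fin n) :
    Integrable (fun t => (Ψ t *ᵥ (B t *ᵥ u t)) j) timeMeasure :=
  (memLp_apply (memLp_mulVec hΨ (memLp_mulVec hB hu)) j).integrable (by norm_num)

theorem steer_add (hΨ : ContinuousOn Ψ (Icc 0 1)) (hB : ContinuousOn B (Icc 0 1))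
    {u v : ℝ → Fin m → ℝ} (hu : MemLp u 2 timeMeasure) (hv : MemLp v 2 timeMeasure) :
    steer Ψ B (u + v) = steer Ψ B u + steer Ψ B v := by
  funext j
  simp only [steer, Pi.add_apply, Matrix.mulVec_add]
  exact integral_add (integrable_steer hΨ hB hu j) (integrable_steer hΨ hB hv j)

theorem steer_smul (c : ℝ) (u : ℝ → Fin m → ℝ) : steer Ψ B (c • u) = c • steer Ψ B u := by
  funext j
  simp only [steer, Pi.smul_apply, Matrix.mulVec_smul]
  exact integral_const_mul _ _

theorem steer_congr_ae {u v : ℝ → Fin m → ℝ} (h : u =ᵐ[timeMeasure] v) :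
    steer Ψ B u = steer Ψ B v := by
  funext j
  exact integral_congr_ae (h.mono fun t ht => by simp only [ht])

theorem dotProduct_steer (hΨ : ContinuousOn Ψ (Icc 0 1)) (hB : ContinuousOn B (Icc 0 1))
    {u : ℝ → Fin m → ℝ} (hu : MemLp u 2 timeMeasure) (q : Fin n → ℝ) :
    q ⬝ᵥ steer Ψ B u = ∫ t, ((q ᵥ* Ψ t) ᵥ* B t) ⬝ᵥ u t ∂timeMeasure := by
  simp only [← Matrix.dotProduct_mulVec]
  simp only [dotProduct, steer]
  rw [integral_finsetSum _ fun j _ => (integrable_steer hΨ hB hu j).const_mul _]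
  simp only [integral_const_mul]

/-- The target is the image of the zero set of `φ` under (x₀, x₁) ↦ N x₁ - x₀. Being affine in
finite dimension, it is both closed and convex. -/
theorem target_eq_coe (M : Matrix (Fin n) (Fin n) ℝ) (N : Matrix (Fin n) (Fin n) ℝ)
    (hMN : M * N = 1) (φ : ((Fin n → ℝ) × (Fin n → ℝ)) →ᵃ[ℝ] (Fin r → ℝ)) :
    ∃ K : AffineSubspace ℝ (Fin n → ℝ), target M φ = K := by
  have hNM : N * M = 1 := mul_eq_one_comm.1 hMN
  let L : ((Fin n → ℝ) × (Fin n → ℝ)) →ₗ[ℝ] (Fin n → ℝ) :=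
    N.mulVecLin ∘ₗ LinearMap.snd ℝ _ _ - LinearMap.fst ℝ _ _
  refine ⟨((AffineSubspace.mk' 0 ⊥ : AffineSubspace ℝ (Fin r → ℝ)).comap φ).map L.toAffineMap, ?_⟩
  ext y
  simp only [target, mem_ofPred_eq, AffineSubspace.coe_map, AffineSubspace.coe_comap, mem_image,
    mem_preimage, SetLike.mem_coe, AffineSubspace.mem_mk', Submodule.mem_bot]
  constructor
  · rintro ⟨x₀, h⟩
    refine ⟨(x₀, M *ᵥ (x₀ + y)), by simpa using h, ?_⟩
    simp [L, hNM]
  · rintro ⟨⟨x₀, x₁⟩, h, rfl⟩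
    refine ⟨x₀, ?_⟩
    simpa [L, hMN] using h

/-- The steering functional is a continuous linear map on `L²`. -/
theorem exists_steer_clm (hΨ : ContinuousOn Ψ (Icc 0 1)) (hB : ContinuousOn B (Icc 0 1)) :
    ∃ S : PiLp 2 (fun _ : Fin m => Lp ℝ 2 timeMeasure) →L[ℝ] (Fin n → ℝ),
      ∀ f, S f = steer Ψ B (fun t i => f i t) := by
  have hg : ∀ j i, MemLp (fun t => (Ψ t * B t) j i) 2 timeMeasure := fun j i =>
    memLp_of_continuousOn (continuousOn_entry
      ((continuous_fst.matrix_mul continuous_snd).comp_continuousOn (hΨ.prodMk hB)) j i)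
  refine ⟨ContinuousLinearMap.pi fun j => ∑ i,
    (innerSL ℝ ((hg j i).toLp _)).comp (PiLp.proj 2 (fun _ : Fin m => Lp ℝ 2 timeMeasure) i),
    fun f => ?_⟩
  funext j
  have h1 : ∀ i, inner ℝ ((hg j i).toLp _) (f i) = ∫ t, (Ψ t * B t) j i * f i t ∂timeMeasure := by
    intro i
    rw [L2.inner_def]
    refine integral_congr_ae ?_
    filter_upwards [(hg j i).coeFn_toLp] with t ht
    simp [ht, mul_comm]
  simp only [ContinuousLinearMap.coe_pi', FunLike.coe_sum, Finset.sum_apply,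
    ContinuousLinearMap.comp_apply, PiLp.proj_apply, innerSL_apply_apply, h1, steer,
    Matrix.mulVec_mulVec]
  simp only [Matrix.mulVec, dotProduct]
  refine (integral_finsetSum _ fun i _ => ?_).symm
  exact (hg j i).integrable_mul (Lp.memLp (f i))

/-- Controls with bound a + 1/(k+1) that steer into `K` form decreasing closed convex subsets of L²;
a common point has bound a. -/
theorem exists_steer_mem_of_forall_gt (hΨ : ContinuousOn Ψ (Icc 0 1))
    (hB : ContinuousOn B (Icc 0 1)) {K : Set (Fin n → ℝ)} (hK : IsClosed K) (hKc : Convex ℝ K)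
    {a : ℝ} (h : ∀ a' > a, ∃ u ∈ box m a', steer Ψ B u ∈ K) :
    ∃ u ∈ box m a, steer Ψ B u ∈ K := by
  obtain ⟨S, hS⟩ := exists_steer_clm hΨ hB
  let c : ℝ → Lp ℝ 2 timeMeasure := fun b => Lp.const 2 timeMeasure b
  have hmem : ∀ b (f : Lp ℝ 2 timeMeasure), f ∈ Icc (c (-b)) (c b) ↔
      ∀ᵐ t ∂timeMeasure, -b ≤ f t ∧ f t ≤ b := fun b f => by
    rw [mem_Icc, ← Lp.coeFn_le, ← Lp.coeFn_le]
    refine eventually_and.symm.trans (eventually_congr ?_)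
    filter_upwards [Lp.coeFn_const (p := 2) (μ := timeMeasure) (-b),
      Lp.coeFn_const (p := 2) (μ := timeMeasure) b] with t h1 h2
    simp only [c, h1, h2, Function.const_apply]
  let C : ℕ → Set (PiLp 2 (fun _ : Fin m => Lp ℝ 2 timeMeasure)) := fun k =>
    (⋂ i, PiLp.proj 2 (fun _ : Fin m => Lp ℝ 2 timeMeasure) (𝕜 := ℝ) i ⁻¹'
      Icc (c (-(a + 1 / ((k : ℝ) + 1)))) (c (a + 1 / ((k : ℝ) + 1)))) ∩ S ⁻¹' K
  have hanti : Antitone C := by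
    refine fun k l hkl => inter_subset_inter_left _ (iInter_mono fun i => preimage_mono ?_)
    intro f hf
    rw [hmem] at hf ⊢
    have : 1 / ((l : ℝ) + 1) ≤ 1 / ((k : ℝ) + 1) := by gcongr
    filter_upwards [hf] with t ht
    constructor <;> linarith [ht.1, ht.2]
  have hne : ∀ k, (C k).Nonempty := fun k => by
    obtain ⟨u, hu, huK⟩ := h (a + 1 / ((k : ℝ) + 1)) (by simp; positivity)
    have hae : ∀ᵐ t ∂timeMeasure, ∀ i, (memLp_apply hu.1 i).toLp _ t = u t i :=
      ae_all_iff.2 fun i => (memLp_apply hu.1 i).coeFn_toLp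
    refine ⟨WithLp.toLp 2 fun i => (memLp_apply hu.1 i).toLp _, mem_iInter.2 fun i => ?_, ?_⟩
    · refine (hmem _ _).2 ?_
      filter_upwards [hu.2, hae] with t ht ht'
      simpa [ht'] using ht i
    · rw [mem_preimage, hS]
      rwa [steer_congr_ae (v := u) (hae.mono fun t ht => funext ht)]
  have hcl : ∀ k, IsClosed (C k) := fun k =>
    (isClosed_iInter fun i => isClosed_Icc.preimage (ContinuousLinearMap.continuous _)).inter
      (hK.preimage S.continuous)
  have hcvI : ∀ b, Convex ℝ (Icc (c (-b)) (c b)) := fun b f hf g hg α β hα hβ hαβ => by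
    rw [hmem] at hf hg ⊢
    filter_upwards [hf, hg, Lp.coeFn_add (α • f) (β • g), Lp.coeFn_smul α f, Lp.coeFn_smul β g]
      with t h1 h2 h3 h4 h5
    rw [h3, Pi.add_apply, h4, h5]
    exact convex_Icc (-b) b h1 h2 hα hβ hαβ
  have hcv : ∀ k, Convex ℝ (C k) := fun k =>
    (convex_iInter fun i => (hcvI _).linear_preimage
      (PiLp.proj 2 (fun _ : Fin m => Lp ℝ 2 timeMeasure) (𝕜 := ℝ) i).toLinearMap).inter
      (hKc.linear_preimage S.toLinearMap)
  -- All the sets lie in `C 0`, where the components are bounded by a + 1.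
  have hR : ∀ k, ∃ x ∈ C k, ‖x‖ ≤ √(∑ _i : Fin m, ‖c (a + 1)‖ ^ 2) := fun k => by
    obtain ⟨f, hf⟩ := hne k
    refine ⟨f, hf, Real.le_sqrt_of_sq_le ?_⟩
    rw [PiLp.norm_sq_eq_of_L2]
    refine Finset.sum_le_sum fun i _ => ?_
    have h1 := (hmem _ _).1 (mem_iInter.1 (hanti (Nat.zero_le k) hf).1 i)
    have : ‖f i‖ ≤ ‖c (a + 1)‖ := by
      refine Lp.norm_le_norm_of_ae_le ?_
      filter_upwards [h1, Lp.coeFn_const (p := 2) (μ := timeMeasure) (a + 1)] with t ht ht'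
      simp only [c, ht', Function.const_apply]
      norm_num at ht
      exact (abs_le.2 ⟨by linarith [ht.1], ht.2⟩).trans (le_abs_self _)
    gcongr
  obtain ⟨f, hf⟩ := nonempty_iInter_of_antitone_convex hanti hne hcl hcv hR
  rw [mem_iInter] at hf
  refine ⟨fun t i => f i t, ⟨memLp_pi_iff.2 fun i => Lp.memLp _, ae_all_iff.2 fun i => ?_⟩, ?_⟩
  · have h1 : ∀ᵐ t ∂timeMeasure, ∀ k : ℕ, -(a + 1 / ((k : ℝ) + 1)) ≤ f i t ∧
        f i t ≤ a + 1 / ((k : ℝ) + 1) :=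
      ae_all_iff.2 fun k => (hmem _ _).1 (mem_iInter.1 (hf k).1 i)
    have h2 : Tendsto (fun k : ℕ => a + 1 / ((k : ℝ) + 1)) atTop (𝓝 a) := by
      simpa using tendsto_one_div_add_atTop_nhds_zero_nat.const_add a
    filter_upwards [h1] with t ht
    exact ⟨le_of_tendsto' h2.neg fun k => (ht k).1, ge_of_tendsto' h2 fun k => (ht k).2⟩
  · have := (hf 0).2
    rwa [mem_preimage, hS] at this

/-- The range of the steering functional is already reached by bounded controls. -/
theorem exists_box_steer_eq (hΨ : ContinuousOn Ψ (Icc 0 1)) (hB : ContinuousOn B (Icc 0 1))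
    {u : ℝ → Fin m → ℝ} (hu : MemLp u 2 timeMeasure) :
    ∃ a, 0 ≤ a ∧ ∃ v ∈ box m a, steer Ψ B v = steer Ψ B u := by
  -- The values reached by bounded controls form a subspace of ℝⁿ, hence a closed set. The
  -- truncations of `u` have values in it that converge to the value of `u`.
  let V : Submodule ℝ (Fin n → ℝ) :=
    { carrier := {y | ∃ a, 0 ≤ a ∧ ∃ v ∈ box m a, steer Ψ B v = y}
      zero_mem' := ⟨0, le_rfl, 0, ⟨MemLp.zero, by simp⟩, by
        simpa using steer_smul (Ψ := Ψ) (B := B) 0 (0 : ℝ → Fin m → ℝ)⟩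
      add_mem' := by
        rintro _ _ ⟨a, ha, v, hv, rfl⟩ ⟨b, hb, w, hw, rfl⟩
        refine ⟨a + b, by positivity, v + w, ⟨hv.1.add hw.1, ?_⟩, steer_add hΨ hB hv.1 hw.1⟩
        filter_upwards [hv.2, hw.2] with t h1 h2 i
        simp only [Pi.add_apply]
        constructor <;> linarith [h1 i, h2 i]
      smul_mem' := by
        rintro c _ ⟨a, ha, v, hv, rfl⟩
        refine ⟨|c| * a, by positivity, c • v, ⟨hv.1.const_smul c, ?_⟩, steer_smul _ _⟩
        filter_upwards [hv.2] with t h1 i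
        rw [← abs_le, Pi.smul_apply, Pi.smul_apply, smul_eq_mul, abs_mul]
        exact mul_le_mul_of_nonneg_left (abs_le.2 (h1 i)) (abs_nonneg c) }
  -- A strongly measurable representative makes the truncation sets measurable.
  obtain ⟨u', hu'm, huu'⟩ := hu.1
  rw [steer_congr_ae huu']
  have hu' : MemLp u' 2 timeMeasure := hu.ae_eq huu'
  have hcl : IsClosed (V : Set (Fin n → ℝ)) := V.closed_of_finiteDimensional
  let w : ℕ → ℝ → Fin m → ℝ := fun k => {t | ‖u' t‖ ≤ k}.indicator u'
  have hset : ∀ k : ℕ, MeasurableSet {t | ‖u' t‖ ≤ k} := fun k =>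
    hu'm.norm.measurable measurableSet_Iic
  change steer Ψ B u' ∈ (V : Set (Fin n → ℝ))
  refine hcl.mem_of_tendsto (f := fun k => steer Ψ B (w k)) (b := atTop) ?_
    (Eventually.of_forall fun k => ⟨k, by positivity, w k, ⟨hu'.indicator (hset k), ?_⟩, rfl⟩)
  · refine tendsto_pi_nhds.2 fun j => ?_
    refine tendsto_integral_of_dominated_convergence
      (fun t => ‖(Ψ t *ᵥ (B t *ᵥ u' t)) j‖) (fun k => ?_) (integrable_steer hΨ hB hu' j).norm
      (fun k => Eventually.of_forall fun t => ?_) (Eventually.of_forall fun t => ?_)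
    · exact (integrable_steer hΨ hB (hu'.indicator (hset k)) j).1
    · by_cases ht : ‖u' t‖ ≤ k
      · simp [w, ht]
      · simp [w, ht]
    · refine tendsto_const_nhds.congr' ?_
      filter_upwards [eventually_ge_atTop ⌈‖u' t‖⌉₊] with k hk
      have : ‖u' t‖ ≤ k := (Nat.le_ceil _).trans (by exact_mod_cast hk)
      simp [w, this]
  · refine Eventually.of_forall fun t i => abs_le.1 ?_
    by_cases ht : ‖u' t‖ ≤ k
    · simpa [w, ht] using (norm_le_pi_norm (u' t) i).trans ht
    · simp [w, ht]

theorem isLeast_criticalBound (h : IsFundamentalPair A Φ Ψ)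
    (hA : ContinuousOn A (Icc 0 1)) (hB : ContinuousOn B (Icc 0 1))
    (hne : (admissible A B φ).Nonempty) :
    IsLeast (feasibleBounds A B φ) (criticalBound A B φ) := by
  have hbdd : BddBelow (feasibleBounds A B φ) := ⟨0, fun a ha => ha.1⟩
  have hlow : criticalBound A B φ ∈ lowerBounds (feasibleBounds A B φ) :=
    fun a ha => csInf_le hbdd ha
  have hnonempty : (feasibleBounds A B φ).Nonempty := by
    obtain ⟨u, hu⟩ := hne
    obtain ⟨huL, huK⟩ := (h.mem_admissible_iff hA hB).1 hu
    obtain ⟨a, ha, v, hv, hvu⟩ := exists_box_steer_eq h.continuousOn_right hB huL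
    exact ⟨a, ha, v, (h.mem_admissible_iff hA hB).2 ⟨hv.1, hvu ▸ huK⟩, hv⟩
  refine ⟨⟨le_csInf hnonempty fun a ha => ha.1, ?_⟩, hlow⟩
  obtain ⟨K, hK⟩ := target_eq_coe _ _ (h.mul_inv (t := 1) (by simp)) φ
  obtain ⟨u, hu, huK⟩ := exists_steer_mem_of_forall_gt (a := criticalBound A B φ)
    h.continuousOn_right hB (K := K) K.closed_of_finiteDimensional K.convex (fun a ha => by
      obtain ⟨b, ⟨hb, v, hv, hvb⟩, hba⟩ := (csInf_lt_iff hbdd hnonempty).1 ha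
      exact ⟨v, box_mono hba.le hvb, hK ▸ ((h.mem_admissible_iff hA hB).1 hv).2⟩)
  exact ⟨u, (h.mem_admissible_iff hA hB).2 ⟨hu.1, hK ▸ huK⟩, hu⟩

end

/-! ### The separating multiplier and the bang-bang law -/

section

variable {n m r : ℕ} {A Φ Ψ : ℝ → Matrix (Fin n) (Fin n) ℝ} {B : ℝ → Matrix (Fin n) (Fin m) ℝ}
  {φ : ((Fin n → ℝ) × (Fin n → ℝ)) →ᵃ[ℝ] (Fin r → ℝ)} {p : ℝ → Fin n → ℝ} {i : Fin m}

theorem add_mem_box {a b : ℝ} {v w : ℝ → Fin m → ℝ} (hv : v ∈ box m a) (hw : w ∈ box m b) :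
    v + w ∈ box m (a + b) := by
  refine ⟨hv.1.add hw.1, ?_⟩
  filter_upwards [hv.2, hw.2] with t h1 h2 i
  simp only [Pi.add_apply]
  constructor <;> linarith [h1 i, h2 i]

theorem smul_mem_box {a : ℝ} {v : ℝ → Fin m → ℝ} (c : ℝ) (hv : v ∈ box m a) :
    c • v ∈ box m (|c| * a) := by
  refine ⟨hv.1.const_smul c, ?_⟩
  filter_upwards [hv.2] with t h1 i
  rw [← abs_le, Pi.smul_apply, Pi.smul_apply, smul_eq_mul, abs_mul]
  exact mul_le_mul_of_nonneg_left (abs_le.2 (h1 i)) (abs_nonneg c)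

theorem zero_mem_box {a : ℝ} (ha : 0 ≤ a) : (0 : ℝ → Fin m → ℝ) ∈ box m a :=
  ⟨MemLp.zero, by simp [ha]⟩

theorem sum_mem_box {ι : Type*} (s : Finset ι) {a : ι → ℝ} {v : ι → ℝ → Fin m → ℝ}
    (hv : ∀ k ∈ s, v k ∈ box m (a k)) : ∑ k ∈ s, v k ∈ box m (∑ k ∈ s, a k) := by
  classical
  induction s using Finset.induction_on with
  | empty => simpa using zero_mem_box le_rfl
  | insert k s hk ih =>
    rw [Finset.sum_insert hk, Finset.sum_insert hk]
    exact add_mem_box (hv k (Finset.mem_insert_self _ _))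
      (ih fun j hj => hv j (Finset.mem_insert_of_mem hj))

theorem steer_zero : steer Ψ B (0 : ℝ → Fin m → ℝ) = 0 := by
  simpa using steer_smul (Ψ := Ψ) (B := B) 0 (0 : ℝ → Fin m → ℝ)

theorem steer_sum (hΨ : ContinuousOn Ψ (Icc 0 1)) (hB : ContinuousOn B (Icc 0 1))
    {ι : Type*} (s : Finset ι) {v : ι → ℝ → Fin m → ℝ}
    (hv : ∀ k ∈ s, MemLp (v k) 2 timeMeasure) :
    steer Ψ B (∑ k ∈ s, v k) = ∑ k ∈ s, steer Ψ B (v k) := by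
  classical
  induction s using Finset.induction_on with
  | empty => simpa using steer_zero
  | insert k s hk ih =>
    have hs := fun j hj => hv j (Finset.mem_insert_of_mem hj)
    rw [Finset.sum_insert hk, Finset.sum_insert hk,
      steer_add hΨ hB (hv k (Finset.mem_insert_self _ _)) (memLp_finsetSum' _ hs), ih hs]

theorem mulVec_single_eq_smul_col (M : Matrix (Fin n) (Fin m) ℝ) (i : Fin m) (c : ℝ) :
    M *ᵥ Pi.single i c = c • M.col i := by
  ext j; simp [mul_comm]

theorem continuousOn_col (hB : ContinuousOn B (Icc 0 1)) (i : Fin m) :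
    ContinuousOn (fun t => (B t).col i) (Icc 0 1) :=
  continuousOn_pi.2 fun j => continuousOn_entry hB j i

/-- A control bringing -z to 0 has steering value Ψ(1) 0 - (-z) = z. -/
theorem exists_box_steer_of_controllable (h : IsFundamentalPair A Φ Ψ)
    (hA : ContinuousOn A (Icc 0 1)) (hB : ContinuousOn B (Icc 0 1))
    (hc : ControllableOn A (fun t => (B t).col i) 0 1) (z : Fin n → ℝ) :
    ∃ a, 0 ≤ a ∧ ∃ v ∈ box m a, steer Ψ B v = z := by
  obtain ⟨v, x, hv, hx, hx0, hx1⟩ := hc (-z)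
  obtain ⟨C, hC⟩ := isCompact_Icc.exists_bound_of_continuousOn hv
  have hxc : ContinuousOn x (Icc 0 1) := fun t ht => (hx t ht).continuousWithinAt
  have hxAC := absolutelyContinuousOnInterval_of_hasDerivWithinAt zero_le_one hx
    ((continuousOn_mulVec hA hxc).add (hv.smul (continuousOn_col hB i)))
  have hu : ContinuousOn (fun t => Pi.single (M := fun _ : Fin m => ℝ) i (v t)) (Icc 0 1) :=
    (continuous_single (A := fun _ : Fin m => ℝ) i).comp_continuousOn hv
  have hC0 : 0 ≤ C := (norm_nonneg _).trans (hC 0 (by simp))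
  refine ⟨C, hC0, fun t => Pi.single i (v t), ⟨memLp_of_continuousOn hu, ?_⟩, ?_⟩
  · filter_upwards [ae_timeMeasure_mem_Icc] with t ht k
    rw [← abs_le]
    rcases eq_or_ne k i with rfl | hk
    · simpa using hC t ht
    · simpa [hk] using hC0
  · rw [h.steer_eq hA hxAC, hx0, hx1]
    · simp
    · filter_upwards [ae_timeMeasure_mem_Ioo] with t ht
      rw [mulVec_single_eq_smul_col]
      exact (hx t (Ioo_subset_Icc_self ht)).hasDerivAt (Icc_mem_nhds ht.1 ht.2)

/-- A quantitative form of surjectivity, obtained by combining preimages of the basis vectors. It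
yields the openness needed for separation. -/
theorem exists_box_norm_steer_eq (hΨ : ContinuousOn Ψ (Icc 0 1)) (hB : ContinuousOn B (Icc 0 1))
    (hs : ∀ z : Fin n → ℝ, ∃ a, 0 ≤ a ∧ ∃ v ∈ box m a, steer Ψ B v = z) :
    ∃ C, 0 ≤ C ∧ ∀ z : Fin n → ℝ, ∃ v ∈ box m (C * ‖z‖), steer Ψ B v = z := by
  choose a ha v hv hvz using fun j : Fin n => hs (Pi.single j 1)
  refine ⟨∑ j, a j, Finset.sum_nonneg fun j _ => ha j, fun z => ⟨∑ j, z j • v j, ?_, ?_⟩⟩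
  · refine box_mono ?_ (sum_mem_box Finset.univ fun j _ => smul_mem_box (z j) (hv j))
    rw [Finset.sum_mul]
    refine Finset.sum_le_sum fun j _ => ?_
    rw [mul_comm]
    exact mul_le_mul_of_nonneg_left (norm_le_pi_norm z j) (ha j)
  · rw [steer_sum hΨ hB _ fun j _ => (hv j).1.const_smul (z j)]
    simp only [steer_smul, hvz]
    ext j; simp [Finset.sum_apply, Pi.single_apply]

/-- If the steering functional is onto on bounded controls, then the critically feasible controls
minimise a nonzero linear functional of the steering functional over the box. -/
theorem exists_multiplier (hΨ : ContinuousOn Ψ (Icc 0 1)) (hB : ContinuousOn B (Icc 0 1))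
    (hs : ∀ z : Fin n → ℝ, ∃ a, 0 ≤ a ∧ ∃ v ∈ box m a, steer Ψ B v = z)
    {K : Set (Fin n → ℝ)} (hK : Convex ℝ K) {a : ℝ} (ha : 0 < a)
    (hne : K.Nonempty) (hlow : ∀ b < a, 0 ≤ b → ∀ v ∈ box m b, steer Ψ B v ∉ K) :
    ∃ q : Fin n → ℝ, q ≠ 0 ∧ ∀ y ∈ K, ∀ v ∈ box m a, q ⬝ᵥ y ≤ q ⬝ᵥ steer Ψ B v := by
  obtain ⟨C, hC0, hC⟩ := exists_box_norm_steer_eq hΨ hB hs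
  set O : Set (Fin n → ℝ) := {y | ∃ b, 0 ≤ b ∧ b < a ∧ ∃ v ∈ box m b, steer Ψ B v = y} with hO
  have hOconv : Convex ℝ O := by
    rintro _ ⟨b, hb0, hb, v, hv, rfl⟩ _ ⟨c, hc0, hc, w, hw, rfl⟩ α β hα hβ hαβ
    refine ⟨α * b + β * c, by positivity, ?_, α • v + β • w, ?_, ?_⟩
    · exact convex_Iio a hb hc hα hβ hαβ
    · have := add_mem_box (smul_mem_box α hv) (smul_mem_box β hw)
      rwa [abs_of_nonneg hα, abs_of_nonneg hβ] at this
    · rw [steer_add hΨ hB (hv.1.const_smul α) (hw.1.const_smul β), steer_smul, steer_smul]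
  have hOopen : IsOpen O := by
    rw [Metric.isOpen_iff]
    rintro _ ⟨b, hb0, hb, v, hv, rfl⟩
    refine ⟨(a - b) / (C + 1), by have := sub_pos.2 hb; positivity, fun y hy => ?_⟩
    obtain ⟨w, hw, hwy⟩ := hC (y - steer Ψ B v)
    rw [Metric.mem_ball, dist_eq_norm, lt_div_iff₀ (by positivity)] at hy
    have hn := norm_nonneg (y - steer Ψ B v)
    refine ⟨b + C * ‖y - steer Ψ B v‖, by positivity, by nlinarith, v + w, add_mem_box hv hw, ?_⟩
    rw [steer_add hΨ hB hv.1 hw.1, hwy, add_sub_cancel]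
  have hdisj : Disjoint O K := by
    rw [Set.disjoint_left]
    rintro _ ⟨b, hb0, hb, v, hv, rfl⟩
    exact hlow b hb hb0 v hv
  obtain ⟨f, c, hfO, hfK⟩ := geometric_hahn_banach_open hOconv hOopen hK hdisj
  have hf : ∀ y, f y = (fun j => f (Pi.single j 1)) ⬝ᵥ y := fun y => by
    conv_lhs => rw [pi_eq_sum_univ' y]
    simp only [map_sum, map_smul, smul_eq_mul, dotProduct]
    exact Finset.sum_congr rfl fun j _ => by rw [mul_comm]
  have h0 : (0 : Fin n → ℝ) ∈ O := ⟨0, le_rfl, ha, 0, zero_mem_box le_rfl, steer_zero⟩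
  -- Hahn-Banach puts O on the lower side of f, so minimality over the box holds for -f. Since 0 ∈
  -- O, the strict inequality rules out f = 0.
  refine ⟨-fun j => f (Pi.single j 1), fun hq => ?_, fun y hy v hv => ?_⟩
  · obtain ⟨k, hk⟩ := hne
    have h1 := hfO 0 h0
    have h2 := hfK k hk
    rw [hf, neg_eq_zero.1 hq] at h1 h2
    simp only [zero_dotProduct] at h1 h2
    linarith
  · rw [neg_dotProduct, neg_dotProduct, ← hf, ← hf, neg_le_neg_iff]
    refine le_trans ?_ (hfK y hy)
    -- A control `v` with bound exactly a is reached as the limit of s • v, s ↑ 1, whose values lie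
    -- in O.
    have h2 : Tendsto (fun s : ℝ => s * f (steer Ψ B v)) (𝓝[<] 1) (𝓝 (f (steer Ψ B v))) := by
      have : Tendsto (fun s : ℝ => s * f (steer Ψ B v)) (𝓝 1) (𝓝 (1 * f (steer Ψ B v))) :=
        tendsto_id.mul_const _
      rw [one_mul] at this
      exact this.mono_left nhdsWithin_le_nhds
    refine le_of_tendsto h2 ?_
    filter_upwards [Ioo_mem_nhdsLT (zero_lt_one (α := ℝ))] with s hs
    have := hfO (steer Ψ B (s • v)) ⟨|s| * a, by positivity, by
      rw [abs_of_pos hs.1]; nlinarith [hs.2], s • v, smul_mem_box s hv, rfl⟩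
    rw [steer_smul, map_smul, smul_eq_mul] at this
    exact this.le

/-! ### The switching function and minimisation over the box -/

theorem vecMul_eq_switching (p : ℝ → Fin n → ℝ) (t : ℝ) (i : Fin m) :
    (p t ᵥ* B t) i = switching B p i t := by
  rw [switching, dotProduct_comm]; rfl

theorem continuousOn_switching (hB : ContinuousOn B (Icc 0 1)) (hp : ContinuousOn p (Icc 0 1))
    (i : Fin m) : ContinuousOn (switching B p i) (Icc 0 1) :=
  (continuous_fst.dotProduct continuous_snd).comp_continuousOn ((continuousOn_col hB i).prodMk hp)

theorem integrable_vecMul_dotProduct (hB : ContinuousOn B (Icc 0 1))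
    (hp : ContinuousOn p (Icc 0 1)) {v : ℝ → Fin m → ℝ} (hv : MemLp v 2 timeMeasure) :
    Integrable (fun t => (p t ᵥ* B t) ⬝ᵥ v t) timeMeasure := by
  simp only [dotProduct, vecMul_eq_switching]
  exact integrable_finsetSum _ fun i _ =>
    (memLp_of_continuousOn (q := 2) (continuousOn_switching hB hp i)).integrable_mul
      (memLp_apply hv i)

/-- Minimisers of a linear functional over the box obey the bang-bang law. -/
theorem bang_bang_of_minimizer (hB : ContinuousOn B (Icc 0 1)) (hp : ContinuousOn p (Icc 0 1))
    {a : ℝ} (ha : 0 ≤ a) {u : ℝ → Fin m → ℝ} (hu : u ∈ box m a)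
    (hmin : ∀ v ∈ box m a, ∫ t, (p t ᵥ* B t) ⬝ᵥ u t ∂timeMeasure ≤
      ∫ t, (p t ᵥ* B t) ⬝ᵥ v t ∂timeMeasure) (i : Fin m) :
    ∀ᵐ t ∂timeMeasure, (switching B p i t < 0 → u t i = a) ∧
      (0 < switching B p i t → u t i = -a) := by
  let g : ℝ → ℝ := fun x => if x < 0 then a else -a
  have hg : Measurable g := Measurable.ite measurableSet_Iio measurable_const measurable_const
  have hgb : ∀ x, |g x| ≤ a := fun x => by
    simp only [g]; split_ifs <;> simp [abs_of_nonneg ha]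
  -- The competitor replaces only the i-th component by the pointwise minimiser, so the integrands
  -- differ by a nonnegative function, whose integral minimality forces to vanish.
  let v : ℝ → Fin m → ℝ := fun t => Function.update (u t) i (g (switching B p i t))
  have hv : v ∈ box m a := by
    refine ⟨memLp_pi_iff.2 fun k => ?_, ?_⟩
    · rcases eq_or_ne k i with rfl | hk
      · simp only [v, Function.update_self]
        exact MemLp.of_bound (hg.comp_aemeasurable (aestronglyMeasurable_of_continuousOn
          (continuousOn_switching hB hp k)).aemeasurable).aestronglyMeasurable a
          (Eventually.of_forall fun t => hgb _)
      · simpa only [v, Function.update_of_ne hk] using memLp_apply hu.1 k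
    · filter_upwards [hu.2] with t ht k
      rcases eq_or_ne k i with rfl | hk
      · simpa only [v, Function.update_self] using abs_le.1 (hgb _)
      · simpa only [v, Function.update_of_ne hk] using ht k
  have hdiff : ∀ t, (p t ᵥ* B t) ⬝ᵥ u t - (p t ᵥ* B t) ⬝ᵥ v t =
      switching B p i t * (u t i - g (switching B p i t)) := fun t => by
    rw [← dotProduct_sub]
    have : u t - v t = Pi.single i (u t i - g (switching B p i t)) := by
      ext k
      rcases eq_or_ne k i with rfl | hk
      · simp [v]
      · simp [v, hk]
    rw [this, dotProduct_single, vecMul_eq_switching]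
  have hnn : 0 ≤ᵐ[timeMeasure] fun t => switching B p i t * (u t i - g (switching B p i t)) := by
    filter_upwards [hu.2] with t ht
    simp only [g, Pi.zero_apply]
    split_ifs with h
    · exact mul_nonneg_of_nonpos_of_nonpos h.le (by linarith [ht i])
    · exact mul_nonneg (not_lt.1 h) (by linarith [ht i])
  have hiu := integrable_vecMul_dotProduct hB hp hu.1
  have hiv := integrable_vecMul_dotProduct hB hp hv.1
  have hint : ∫ t, switching B p i t * (u t i - g (switching B p i t)) ∂timeMeasure = 0 := by
    refine le_antisymm ?_ (integral_nonneg_of_ae hnn)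
    simp only [← hdiff]
    rw [integral_sub hiu hiv]
    linarith [hmin v hv]
  have hzero := (integral_eq_zero_iff_of_nonneg_ae hnn
    ((hiu.sub hiv).congr (Eventually.of_forall hdiff))).1 hint
  filter_upwards [hzero] with t ht
  simp only [Pi.zero_apply, mul_eq_zero, sub_eq_zero] at ht
  constructor
  · intro h
    rw [ht.resolve_left h.ne]; simp [g, h]
  · intro h
    rw [ht.resolve_left h.ne']; simp [g, h.le]

/-! ### Singular arcs -/

/-- On a singular arc p · x is constant for every controlled trajectory. The one steered from p(s)
to 0 gives |p(s)|² = 0. -/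
theorem no_singular_arc {b : ℝ → Fin n → ℝ} (hb : ContinuousOn b (Icc 0 1))
    (hp : IsAdjoint A p) {s s' : ℝ} (hs : 0 ≤ s) (hss' : s < s') (hs' : s' ≤ 1)
    (hps : p s ≠ 0) (hc : ControllableOn A b s s') :
    ¬ ∀ᵐ t ∂(volume.restrict (Icc s s')), b t ⬝ᵥ p t = 0 := by
  intro hae
  have hsub : Icc s s' ⊆ Icc 0 1 := Icc_subset_Icc hs hs'
  have hzero : EqOn (fun t => b t ⬝ᵥ p t) (fun _ => 0) (Icc s s') :=
    Measure.eqOn_Icc_of_ae_eq volume hss'.ne hae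
      ((continuous_fst.dotProduct continuous_snd).comp_continuousOn
        ((hb.mono hsub).prodMk (hp.continuousOn.mono hsub))) continuousOn_const
  obtain ⟨v, x, -, hx, hxs, hxs'⟩ := hc (p s)
  have hd : ∀ t ∈ Icc s s', HasDerivWithinAt (fun t => p t ⬝ᵥ x t) 0 (Icc s s') t := fun t ht => by
    have := hasDerivWithinAt_dotProduct ((hp t (hsub ht)).mono hsub) (hx t ht)
    rwa [neg_transpose_mulVec_dotProduct_add, dotProduct_smul, dotProduct_comm,
      show b t ⬝ᵥ p t = 0 from hzero ht,
      smul_zero] at this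
  have := eq_of_hasDerivWithinAt_Icc_zero hd (right_mem_Icc.2 hss'.le)
  rw [hxs', hxs, dotProduct_zero] at this
  exact hps (dotProduct_self_eq_zero.1 this.symm)

end

/-! ### Analyticity of solutions of analytic linear equations -/

/-- The Taylor coefficients of the solution of `x' = M x`, `x 0 = x₀`, for `M = ∑ zˡ M_l`. -/
noncomputable def odeCoeff {n : ℕ} (M : ℕ → Matrix (Fin n) (Fin n) ℝ) (x₀ : Fin n → ℝ) :
    ℕ → Fin n → ℝ
  | 0 => x₀
  | k + 1 => ((k : ℝ) + 1)⁻¹ • ∑ l : Fin (k + 1), M l *ᵥ odeCoeff M x₀ (k - l)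
  termination_by k => k
  decreasing_by omega

theorem odeCoeff_succ {n : ℕ} (M : ℕ → Matrix (Fin n) (Fin n) ℝ) (x₀ : Fin n → ℝ) (k : ℕ) :
    ((k : ℝ) + 1) • odeCoeff M x₀ (k + 1) =
      ∑ l ∈ Finset.range (k + 1), M l *ᵥ odeCoeff M x₀ (k - l) := by
  rw [odeCoeff, smul_smul, mul_inv_cancel₀ (by positivity), one_smul,
    Finset.sum_range fun l => M l *ᵥ odeCoeff M x₀ (k - l)]

/-- Each of the k + 1 terms in the recursion is at most C ‖x₀‖ (R + C)ᵏ, and their number cancels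
the factor 1/(k + 1). -/
theorem norm_odeCoeff_le {n : ℕ} {M : ℕ → Matrix (Fin n) (Fin n) ℝ} (x₀ : Fin n → ℝ) {C R : ℝ}
    (hC : 0 ≤ C) (hR : 0 ≤ R) (hM : ∀ l v, ‖M l *ᵥ v‖ ≤ C * R ^ l * ‖v‖) (k : ℕ) :
    ‖odeCoeff M x₀ k‖ ≤ ‖x₀‖ * (R + C) ^ k := by
  induction k using Nat.strong_induction_on with
  | _ k ih =>
    rcases k with _ | k
    · simp [odeCoeff]
    have h1 : ∀ l ∈ Finset.range (k + 1),
        ‖M l *ᵥ odeCoeff M x₀ (k - l)‖ ≤ C * ‖x₀‖ * (R + C) ^ k := fun l hl => by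
      have hl' : l ≤ k := Nat.lt_succ_iff.1 (Finset.mem_range.1 hl)
      calc _ ≤ C * R ^ l * ‖odeCoeff M x₀ (k - l)‖ := hM _ _
        _ ≤ C * (R + C) ^ l * (‖x₀‖ * (R + C) ^ (k - l)) := by
            gcongr
            · linarith
            · exact ih _ (by omega)
        _ = C * ‖x₀‖ * ((R + C) ^ l * (R + C) ^ (k - l)) := by ring
        _ = _ := by rw [← pow_add, Nat.add_sub_cancel' hl']
    have h2 := (norm_sum_le _ _).trans (Finset.sum_le_sum h1)
    rw [← odeCoeff_succ, norm_smul, Real.norm_of_nonneg (by positivity), Finset.sum_const,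
      Finset.card_range, nsmul_eq_mul, Nat.cast_add, Nat.cast_one] at h2
    have h3 := le_of_mul_le_mul_left h2 (by positivity)
    refine h3.trans ?_
    rw [pow_succ]
    have : 0 ≤ ‖x₀‖ * (R + C) ^ k * R := by positivity
    nlinarith

/-- The formal power series solution converges by a geometric majorant, and termwise differentiation
shows that it solves the equation. -/
theorem exists_analytic_solution {n : ℕ} {M : ℝ → Matrix (Fin n) (Fin n) ℝ} {t₀ : ℝ}
    (hM : ∀ j k, AnalyticAt ℝ (fun t => M t j k) t₀) (x₀ : Fin n → ℝ) :
    ∃ y : ℝ → Fin n → ℝ, y t₀ = x₀ ∧ AnalyticAt ℝ y t₀ ∧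
      ∀ᶠ t in 𝓝 t₀, HasDerivAt y (M t *ᵥ y t) t := by
  choose q hq using hM
  choose c r hc hr hcr using fun j k => (q j k).le_mul_pow_of_radius_pos (hq j k).radius_pos
  set N : ℕ → Matrix (Fin n) (Fin n) ℝ := fun l => Matrix.of fun j k => (q j k).coeff l with hN
  set C : ℝ := ∑ j, ∑ k, c j k with hCdef
  set R : ℝ := 1 + ∑ j, ∑ k, r j k with hRdef
  have hC0 : 0 ≤ C := Finset.sum_nonneg fun j _ => Finset.sum_nonneg fun k _ => (hc j k).le
  have hR1 : 1 ≤ R := le_add_of_nonneg_right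
    (Finset.sum_nonneg fun j _ => Finset.sum_nonneg fun k _ => (hr j k).le)
  have hrR : ∀ j k, r j k ≤ R := fun j k => by
    have h1 : r j k ≤ ∑ k, r j k :=
      Finset.single_le_sum (f := fun k => r j k) (fun k _ => (hr j k).le) (Finset.mem_univ k)
    have h2 : ∑ k, r j k ≤ ∑ j, ∑ k, r j k :=
      Finset.single_le_sum (f := fun j => ∑ k, r j k)
        (fun j _ => Finset.sum_nonneg fun k _ => (hr j k).le) (Finset.mem_univ j)
    linarith
  have hcoef : ∀ l j k, |N l j k| ≤ c j k * R ^ l := fun l j k => by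
    have := hcr j k l
    rw [← Real.norm_eq_abs]
    simp only [hN, Matrix.of_apply]
    rw [← FormalMultilinearSeries.norm_apply_eq_norm_coef] at *
    refine this.trans ?_
    have := (hr j k).le
    have := (hc j k).le
    gcongr
    exact hrR j k
  have hNbound : ∀ l v, ‖N l *ᵥ v‖ ≤ C * R ^ l * ‖v‖ := fun l v => by
    refine (pi_norm_le_iff_of_nonneg (by positivity)).2 fun j => ?_
    calc ‖(N l *ᵥ v) j‖ ≤ ∑ k, ‖N l j k * v k‖ :=
          norm_sum_le Finset.univ fun k => N l j k * v k
      _ ≤ ∑ k, c j k * R ^ l * ‖v‖ := by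
          refine Finset.sum_le_sum fun k _ => ?_
          rw [norm_mul]
          exact mul_le_mul (hcoef l j k) (norm_le_pi_norm v k) (norm_nonneg _)
            ((abs_nonneg _).trans (hcoef l j k))
      _ = (∑ k, c j k) * R ^ l * ‖v‖ := by rw [Finset.sum_mul, Finset.sum_mul]
      _ ≤ _ := by
          gcongr
          exact Finset.single_le_sum (f := fun j => ∑ k, c j k)
            (fun j _ => Finset.sum_nonneg fun k _ => (hc j k).le) (Finset.mem_univ j)
  set S : ℝ := R + C with hS
  have hS0 : 0 < S := by linarith
  set a : ℕ → Fin n → ℝ := odeCoeff N x₀ with ha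
  have hab : ∀ k, ‖a k‖ ≤ ‖x₀‖ * S ^ k :=
    norm_odeCoeff_le x₀ hC0 (by linarith) hNbound
  -- Half the radius guaranteed by the bound ‖x₀‖ Sᵏ, so the terms are dominated by ‖x₀‖ 2⁻ᵏ.
  set δ : ℝ := (2 * S)⁻¹ with hδ
  have hδ0 : 0 < δ := by positivity
  have hSδ : S * δ = 1 / 2 := by rw [hδ]; field_simp
  set y : ℝ → Fin n → ℝ := fun t => ∑' k, (t - t₀) ^ k • a k with hy
  have hpow : ∀ z : ℝ, |z| ≤ δ → ∀ k, ‖z ^ k • a k‖ ≤ ‖x₀‖ * (1 / 2) ^ k := fun z hz k => by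
    rw [norm_smul, norm_pow, Real.norm_eq_abs, ← hSδ, mul_pow]
    calc |z| ^ k * ‖a k‖ ≤ δ ^ k * (‖x₀‖ * S ^ k) := by gcongr; exact hab k
      _ = _ := by ring
  have hgeo : Summable fun k : ℕ => ‖x₀‖ * (1 / 2 : ℝ) ^ k :=
    (summable_geometric_of_lt_one (by norm_num) (by norm_num)).mul_left _
  have hsum : ∀ z : ℝ, |z| ≤ δ → Summable fun k => ‖z ^ k • a k‖ := fun z hz =>
    Summable.of_nonneg_of_le (fun _ => norm_nonneg _) (hpow z hz) hgeo
  have hball : ∀ t ∈ Metric.ball t₀ δ, |t - t₀| < δ := fun t ht => by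
    rwa [Metric.mem_ball, Real.dist_eq] at ht
  refine ⟨y, ?_, ?_, ?_⟩
  · simp only [hy, sub_self]
    rw [tsum_eq_single 0 fun k hk => by simp [hk]]
    simp [ha, odeCoeff]
  · let P : FormalMultilinearSeries ℝ ℝ (Fin n → ℝ) := fun k =>
      ContinuousMultilinearMap.mkPiRing ℝ (Fin k) (a k)
    refine ⟨P, hasFPowerSeriesAt_iff'.2 ?_⟩
    filter_upwards [Metric.ball_mem_nhds t₀ hδ0] with t ht
    have := (hsum _ (hball t ht).le).of_norm.hasSum
    simpa [P, FormalMultilinearSeries.coeff] using this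
  · have hMs : ∀ᶠ t in 𝓝 t₀, ∀ j k, HasSum (fun l => (t - t₀) ^ l * N l j k) (M t j k) :=
      eventually_all.2 fun j => eventually_all.2 fun k => by
        simpa [hN] using hasFPowerSeriesAt_iff'.1 (hq j k)
    filter_upwards [Metric.ball_mem_nhds t₀ hδ0, hMs] with t ht hMt
    have hu : Summable fun k : ℕ => ‖x₀‖ * S * (k * (1 / 2 : ℝ) ^ (k - 1)) := by
      refine Summable.mul_left _ ?_
      have := (summable_pow_mul_geometric_of_norm_lt_one (R := ℝ) 1 (r := 1 / 2)
        (by norm_num)).mul_left 2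
      refine this.congr fun k => ?_
      rcases k with _ | k
      · simp
      · rw [Nat.add_sub_cancel, pow_succ]; ring
    have hder' : ∀ k : ℕ, ∀ s ∈ Metric.ball t₀ δ, ‖((k : ℝ) * (s - t₀) ^ (k - 1)) • a k‖ ≤
        ‖x₀‖ * S * (k * (1 / 2 : ℝ) ^ (k - 1)) := fun k s hs => by
      rcases k with _ | k
      · simp
      rw [norm_smul, norm_mul, norm_pow, Real.norm_eq_abs (s - t₀), Real.norm_natCast,
        Nat.add_sub_cancel, ← hSδ, mul_pow]
      calc ((k + 1 : ℕ) : ℝ) * |s - t₀| ^ k * ‖a (k + 1)‖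
          ≤ (k + 1 : ℕ) * δ ^ k * (‖x₀‖ * S ^ (k + 1)) := by
            gcongr
            · exact (hball s hs).le
            · exact hab _
        _ = _ := by ring
    have hder := hasDerivAt_tsum_of_isPreconnected (𝕜 := ℝ)
      (u := fun k : ℕ => ‖x₀‖ * S * (k * (1 / 2 : ℝ) ^ (k - 1)))
      (g := fun (k : ℕ) t => (t - t₀) ^ k • a k)
      (g' := fun (k : ℕ) t => ((k : ℝ) * (t - t₀) ^ (k - 1)) • a k)
      (t := Metric.ball t₀ δ) (y₀ := t₀) (y := t) hu Metric.isOpen_ball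
      (convex_ball t₀ δ).isPreconnected ?_ hder' (Metric.mem_ball_self hδ0) ?_ ht
    · have hz := hball t ht
      have hsucc : ∀ k : ℕ, (((k + 1 : ℕ) : ℝ) * (t - t₀) ^ (k + 1 - 1)) • a (k + 1) =
          (t - t₀) ^ k • ∑ l ∈ Finset.range (k + 1), N l *ᵥ a (k - l) := fun k => by
        rw [← odeCoeff_succ, smul_smul, Nat.add_sub_cancel, mul_comm]
        push_cast; rfl
      have hval : ∑' k : ℕ, ((k : ℝ) * (t - t₀) ^ (k - 1)) • a k = M t *ᵥ y t := by
        have hTs : Summable fun k : ℕ => ((k : ℝ) * (t - t₀) ^ (k - 1)) • a k :=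
          Summable.of_norm_bounded hu fun k => hder' k t ht
        rw [hTs.tsum_eq_zero_add]
        simp only [hsucc, Nat.cast_zero, zero_mul, zero_smul, zero_add]
        funext j
        have hs1 : HasSum (fun k => ((t - t₀) ^ k • ∑ l ∈ Finset.range (k + 1),
            N l *ᵥ a (k - l)) j) ((∑' k, (t - t₀) ^ k • ∑ l ∈ Finset.range (k + 1),
            N l *ᵥ a (k - l)) j) := by
          have := (summable_nat_add_iff 1).2 hTs
          simp only [hsucc] at this
          exact Pi.hasSum.1 this.hasSum j
        refine hs1.unique ?_
        have hyi : ∀ i, HasSum (fun k => (t - t₀) ^ k * a k i) (y t i) := fun i =>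
          Pi.hasSum.1 (hsum _ hz.le).of_norm.hasSum i
        -- The Cauchy product of the entry series with the solution series.
        have hs2 : ∀ i, HasSum (fun k => ∑ l ∈ Finset.range (k + 1),
            (t - t₀) ^ l * N l j i * ((t - t₀) ^ (k - l) * a (k - l) i)) (M t j i * y t i) :=
          fun i => by
            have h1 := (hMt j i).summable.norm
            have h2 := (hyi i).summable.norm
            rw [← (hMt j i).tsum_eq, ← (hyi i).tsum_eq,
              tsum_mul_tsum_eq_tsum_sum_range_of_summable_norm h1 h2]
            exact (summable_norm_sum_mul_range_of_summable_norm h1 h2).of_norm.hasSum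
        have hs3 := hasSum_sum fun i (_ : i ∈ Finset.univ) => hs2 i
        convert! hs3 using 1
        funext k
        rw [Finset.sum_comm]
        simp only [Pi.smul_apply, Finset.sum_apply, smul_eq_mul, Finset.mul_sum, Matrix.mulVec,
          dotProduct]
        refine Finset.sum_congr rfl fun l hl => Finset.sum_congr rfl fun i _ => ?_
        rw [← Nat.add_sub_cancel' (Nat.lt_succ_iff.1 (Finset.mem_range.1 hl)), pow_add,
          Nat.add_sub_cancel_left]
        ring
      rw [← hval]
      exact hder
    · intro k s _
      have := ((hasDerivAt_id s).sub_const t₀).fun_pow k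
      simpa using this.smul_const (a k)
    · simpa using (hsum 0 (by simpa using hδ0.le)).of_norm

/-- Local uniqueness identifies the given solution with the power series one. -/
theorem analyticAt_of_linear_ode {n : ℕ} {M : ℝ → Matrix (Fin n) (Fin n) ℝ} {x : ℝ → Fin n → ℝ}
    {t₀ : ℝ} (hM : ∀ j k, AnalyticAt ℝ (fun t => M t j k) t₀)
    (hx : ∀ᶠ t in 𝓝 t₀, HasDerivAt x (M t *ᵥ x t) t) : AnalyticAt ℝ x t₀ := by
  obtain ⟨y, hy0, hya, hy⟩ := exists_analytic_solution hM (x t₀)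
  refine hya.congr ?_
  have hM1 : ∀ᶠ t in 𝓝 t₀, ∀ j k, |M t j k| ≤ |M t₀ j k| + 1 :=
    eventually_all.2 fun j => eventually_all.2 fun k =>
      ((hM j k).continuousAt.abs.eventually_lt_const (lt_add_one _)).mono fun t ht => ht.le
  have hL : ∀ᶠ t in 𝓝 t₀, LipschitzOnWith (∑ j, ∑ k, (|M t₀ j k| + 1)).toNNReal
      (fun v => M t *ᵥ v) univ := by
    filter_upwards [hM1] with t ht
    refine LipschitzOnWith.of_dist_le_mul fun v _ w _ => ?_
    have h0 : ∀ j, 0 ≤ ∑ k, (|M t₀ j k| + 1) := fun j => by positivity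
    rw [dist_eq_norm, dist_eq_norm, ← Matrix.mulVec_sub,
      Real.coe_toNNReal _ (Finset.sum_nonneg fun j _ => h0 j)]
    refine (pi_norm_le_iff_of_nonneg (by positivity)).2 fun j => ?_
    calc ‖(M t *ᵥ (v - w)) j‖ ≤ ∑ k, ‖M t j k * (v - w) k‖ :=
          norm_sum_le Finset.univ fun k => M t j k * (v - w) k
      _ ≤ ∑ k, (|M t₀ j k| + 1) * ‖v - w‖ := by
          refine Finset.sum_le_sum fun k _ => ?_
          rw [norm_mul]
          exact mul_le_mul (ht j k) (norm_le_pi_norm (v - w) k) (norm_nonneg _) (by positivity)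
      _ = (∑ k, (|M t₀ j k| + 1)) * ‖v - w‖ := by rw [Finset.sum_mul]
      _ ≤ _ := by
          refine mul_le_mul_of_nonneg_right ?_ (norm_nonneg _)
          exact Finset.single_le_sum (f := fun j => ∑ k, (|M t₀ j k| + 1)) (fun j _ => h0 j)
            (Finset.mem_univ j)
  exact ODE_solution_unique_of_eventually hL (hy.mono fun t ht => ⟨ht, mem_univ _⟩)
    (hx.mono fun t ht => ⟨ht, mem_univ _⟩) hy0

/-- By the identity theorem, an analytic function that is not identically zero on the interval is
nonzero on a codiscrete subset, whose complement is null. -/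
theorem ae_ne_zero_of_analytic {f : ℝ → ℝ} (hf : AnalyticOnNhd ℝ f (Ioo 0 1))
    (hne : ¬ ∀ᵐ t ∂timeMeasure, f t = 0) : ∀ᵐ t ∂timeMeasure, f t ≠ 0 := by
  rcases hf.eqOn_zero_or_eventually_ne_zero_of_preconnected isPreconnected_Ioo with h | h
  · exact absurd (ae_timeMeasure_mem_Ioo.mono fun t ht => h ht) hne
  · rw [timeMeasure, ← restrict_Ioo_eq_restrict_Icc]
    exact ae_restrict_le_codiscreteWithin measurableSet_Ioo h

theorem analyticOnNhd_switching {n m : ℕ} {A : ℝ → Matrix (Fin n) (Fin n) ℝ}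
    {B : ℝ → Matrix (Fin n) (Fin m) ℝ} {p : ℝ → Fin n → ℝ} {i : Fin m} (hp : IsAdjoint A p)
    (hA : ∀ j k, AnalyticOn ℝ (fun t => A t j k) (Icc 0 1))
    (hB : ∀ j, AnalyticOn ℝ (fun t => B t j i) (Icc 0 1)) :
    AnalyticOnNhd ℝ (switching B p i) (Ioo 0 1) := by
  have hint : ∀ {f : ℝ → ℝ}, AnalyticOn ℝ f (Icc 0 1) → AnalyticOnNhd ℝ f (Ioo 0 1) :=
    fun hf => isOpen_Ioo.analyticOn_iff_analyticOnNhd.1 (hf.mono Ioo_subset_Icc_self)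
  intro t ht
  have hpa : AnalyticAt ℝ p t := by
    refine analyticAt_of_linear_ode (M := fun t => -(A t)ᵀ) (fun j k => ?_) ?_
    · exact (hint (hA k j) t ht).neg
    · filter_upwards [Ioo_mem_nhds ht.1 ht.2] with s hs
      rw [Matrix.neg_mulVec]
      exact (hp s (Ioo_subset_Icc_self hs)).hasDerivAt (Icc_mem_nhds hs.1 hs.2)
  exact Finset.univ.analyticAt_fun_sum (f := fun j t => B t j i * p t j) fun j _ =>
    (hint (hB j) t ht).fun_mul (analyticAt_pi_iff.1 hpa j)

/-! ### The critical control theorem -/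

theorem steer_eq_zero_of_mem_box_zero {n m : ℕ} {Ψ : ℝ → Matrix (Fin n) (Fin n) ℝ}
    {B : ℝ → Matrix (Fin n) (Fin m) ℝ} {u : ℝ → Fin m → ℝ} (hu : u ∈ box m 0) :
    steer Ψ B u = 0 := by
  rw [← steer_zero (m := m) (Ψ := Ψ) (B := B)]
  refine steer_congr_ae (hu.2.mono fun t ht => funext fun i => ?_)
  have := ht i
  simp only [Pi.zero_apply]
  linarith

theorem exists_multiplier_of_isLeast {n m r : ℕ} (hn : 0 < n)
    {A Φ Ψ : ℝ → Matrix (Fin n) (Fin n) ℝ} {B : ℝ → Matrix (Fin n) (Fin m) ℝ}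
    {φ : ((Fin n → ℝ) × (Fin n → ℝ)) →ᵃ[ℝ] (Fin r → ℝ)} (h : IsFundamentalPair A Φ Ψ)
    (hA : ContinuousOn A (Icc 0 1)) (hB : ContinuousOn B (Icc 0 1)) {a : ℝ}
    (ha : IsLeast (feasibleBounds A B φ) a) :
    ∃ q : Fin n → ℝ, q ≠ 0 ∧ ∀ i, ControllableWrt A B i → ∀ u ∈ admissible A B φ ∩ box m a,
      ∀ v ∈ box m a, q ⬝ᵥ steer Ψ B u ≤ q ⬝ᵥ steer Ψ B v := by
  have : Nonempty (Fin n) := ⟨⟨0, hn⟩⟩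
  have hadm := fun u => h.mem_admissible_iff (φ := φ) (u := u) hA hB
  by_cases hc : 0 < a ∧ ∃ i, ControllableWrt A B i
  · obtain ⟨ha0, i, hi⟩ := hc
    obtain ⟨K, hK⟩ := target_eq_coe _ _ (h.mul_inv (t := 1) (by simp)) φ
    obtain ⟨u, hu, hua⟩ := ha.1.2
    obtain ⟨q, hq, hmin⟩ := exists_multiplier h.continuousOn_right hB
      (exists_box_steer_of_controllable h hA hB (hi 0 1 le_rfl zero_lt_one le_rfl))
      (K := target (Φ 1) φ) (hK ▸ K.convex) ha0 ⟨_, ((hadm u).1 hu).2⟩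
      fun b hb hb0 v hv hvK => hb.not_ge (ha.2 ⟨hb0, v, (hadm v).2 ⟨hv.1, hvK⟩, hv⟩)
    exact ⟨q, hq, fun _ _ u hu v hv => hmin _ ((hadm u).1 hu.1).2 v hv⟩
  -- Either no component is controllable and the claim is vacuous, or a = 0 and all controls in the
  -- box steer to 0. Any nonzero q then serves.
  · refine ⟨fun _ => 1, fun h1 => one_ne_zero (congrFun h1 (Classical.arbitrary _)),
      fun i hi u hu v hv => ?_⟩
    obtain rfl : a = 0 := le_antisymm (not_lt.1 fun h0 => hc ⟨h0, i, hi⟩) ha.1.1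
    rw [steer_eq_zero_of_mem_box_zero hu.2, steer_eq_zero_of_mem_box_zero hv]

end CriticalControl

theorem mainTheorem2 {n m r : ℕ} (hn : 0 < n)
    (A : ℝ → Matrix (Fin n) (Fin n) ℝ) (B : ℝ → Matrix (Fin n) (Fin m) ℝ)
    (hA : ContinuousOn A (Set.Icc 0 1)) (hB : ContinuousOn B (Set.Icc 0 1))
    (φ : ((Fin n → ℝ) × (Fin n → ℝ)) →ᵃ[ℝ] (Fin r → ℝ))
    (h𝓐 : (CriticalControl.admissible A B φ).Nonempty) :
    IsLeast (CriticalControl.feasibleBounds A B φ) (CriticalControl.criticalBound A B φ) ∧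
    ∃ p : ℝ → Fin n → ℝ, CriticalControl.IsAdjoint A p ∧ (∀ t ∈ Set.Icc (0 : ℝ) 1, p t ≠ 0) ∧
      ∀ u ∈ CriticalControl.admissible A B φ ∩
          CriticalControl.box m (CriticalControl.criticalBound A B φ),
        ∀ i : Fin m, CriticalControl.ControllableWrt A B i →
          -- no singular arc, and the bang-bang law off the zeros of the switching function
          (∀ s s' : ℝ, 0 ≤ s → s < s' → s' ≤ 1 →
            ¬ ∀ᵐ t ∂(MeasureTheory.volume.restrict (Set.Icc s s')),
              CriticalControl.switching B p i t = 0) ∧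
          (∀ᵐ t ∂CriticalControl.timeMeasure,
            (CriticalControl.switching B p i t < 0 →
              u t i = CriticalControl.criticalBound A B φ) ∧
            (0 < CriticalControl.switching B p i t →
              u t i = -CriticalControl.criticalBound A B φ)) ∧
          -- the full bang-bang law, for real-analytic data
          ((∀ j k, AnalyticOn ℝ (fun t => A t j k) (Set.Icc 0 1)) →
            (∀ j, AnalyticOn ℝ (fun t => B t j i) (Set.Icc 0 1)) →
            ∀ᵐ t ∂CriticalControl.timeMeasure,
              CriticalControl.switching B p i t ≠ 0 ∧
              (CriticalControl.switching B p i t ≤ 0 →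
                u t i = CriticalControl.criticalBound A B φ) ∧
              (0 < CriticalControl.switching B p i t →
                u t i = -CriticalControl.criticalBound A B φ)) := by
  obtain ⟨Φ, Ψ, h⟩ := CriticalControl.exists_isFundamentalPair hA
  have hleast := CriticalControl.isLeast_criticalBound h hA hB h𝓐
  refine ⟨hleast, ?_⟩
  set a := CriticalControl.criticalBound A B φ with ha
  have ha0 : 0 ≤ a := hleast.1.1
  obtain ⟨q, hq, hmin⟩ := CriticalControl.exists_multiplier_of_isLeast hn h hA hB hleast
  have hp : CriticalControl.IsAdjoint A (fun t => q ᵥ* Ψ t) := h.adjoint q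
  have hpne : ∀ t ∈ Set.Icc (0 : ℝ) 1, q ᵥ* Ψ t ≠ 0 := fun t ht h0 => hq <| by
    rw [← Matrix.vecMul_one q, ← h.inv_mul t ht, ← Matrix.vecMul_vecMul, h0, Matrix.zero_vecMul]
  refine ⟨_, hp, hpne, fun u hu i hi => ?_⟩
  have hsing : ∀ s s' : ℝ, 0 ≤ s → s < s' → s' ≤ 1 →
      ¬ ∀ᵐ t ∂(volume.restrict (Set.Icc s s')),
        CriticalControl.switching B (fun t => q ᵥ* Ψ t) i t = 0 := fun s s' hs hss' hs' =>
    CriticalControl.no_singular_arc (CriticalControl.continuousOn_col hB i) hp hs hss' hs'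
      (hpne s ⟨hs, hss'.le.trans hs'⟩) (hi s s' hs hss' hs')
  have hbang := CriticalControl.bang_bang_of_minimizer hB hp.continuousOn ha0 hu.2
    (fun v hv => by
      rw [← CriticalControl.dotProduct_steer h.continuousOn_right hB hu.2.1,
        ← CriticalControl.dotProduct_steer h.continuousOn_right hB hv.1]
      exact hmin i hi u hu v hv) i
  refine ⟨hsing, hbang, fun hAa hBa => ?_⟩
  have hne := CriticalControl.ae_ne_zero_of_analytic
    (CriticalControl.analyticOnNhd_switching hp hAa hBa)
    (hsing 0 1 le_rfl zero_lt_one le_rfl)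
  filter_upwards [hbang, hne] with t ht hnt
  exact ⟨hnt, fun hle => ht.1 (lt_of_le_of_ne hle hnt), ht.2⟩
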